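/- Let $n\ge 2$ be an integer. For $r>0$ let $B(0,r)\subset\mathbb{R}^n$ be the open ball and $B(0,r)^+=\{x\in B(0,r): x_n>0\}$ its upper half; identify $\mathbb{R}^{n-1}$ with $\{x\in\mathbb{R}^n: x_n=0\}$. Let $H^1_\infty(A)=\inf\{\sum_i \operatorname{diam} A_i : A\subset\bigcup_{i\in\mathbb{N}} A_i\}$ denote the one-dimensional Hausdorff content. A Whitney decomposition of an open set $\Omega$ is a family of closed axis-parallel cubes with pairwise disjoint interiors whose union is $\Omega$ and which satisfy $\operatorname{diam} Q\le \operatorname{dist}(Q,\mathbb{R}^n\setminus\Omega)\le 4\operatorname{diam} Q$. For $0<r<1$, call $u$ admissible for $r$ if there are a compact set $F\subset B(0,r)\cap\mathbb{R}^{n-1}$ with $H^1_\infty(F)\ge r/3$, a Whitney decomposition $\mathcal{W}$ of $B(0,r)^+$ and a cube $Q_1\in\mathcal{W}$ of largest size in $\mathcal{W}$ such that $u\in C^1(B(0,r)^+)\cap C(B(0,r)^+\cup F)$, $u=0$ on $F$, and the average of $u$ over $Q_1$ satisfies $\frac{1}{|Q_1|}\int_{Q_1}u\,dx\ge\frac12$.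 Let $p,\lambda\in\mathbb{R}$. (1) If $n-1<p\le n$ and $\lambda\ge 0$, there is a constant $C=C(n,p,\lambda)>0$ such that for all $0<r<1$ and all $u$ admissible for $r$, $$\int_{B(0,r)^+}|\nabla u|^p\log^{\lambda}(e+|\nabla u|)\,dx\ \ge\ C\,r^{n-p}\log^{\lambda}(1/r).$$ If $n-1<p\le n$ and $\lambda<0$, then for every $r_0\in(0,1)$ there is a constant $C=C(n,p,\lambda,r_0)>0$ such that the same inequality holds for all $0<r\le r_0$ and all $u$ admissible for $r$. (2) If $p=n-1$ and $\lambda>n-2$, there is a constant $C=C(n,\lambda)>0$ such that for all $0<r<1$ and all $u$ admissible for $r$, $$\int_{B(0,r)^+}|\nabla u|^{n-1}\log^{\lambda}(e+|\nabla u|)\,dx\ \ge\ C\,r\log^{\lambda-(n-2)}(1/r).$$ The integrals may be infinite. -/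

import Mathlib

open MeasureTheory Set
open scoped ENNReal

/-- The open upper half `B(0,r)⁺` of the ball `B(0,r)` in `ℝⁿ`, where `n = m + 1`. -/
def upperHalfBall (m : ℕ) (r : ℝ) : Set (EuclideanSpace ℝ (Fin (m + 1))) :=
  {x | x ∈ Metric.ball 0 r ∧ 0 < x (Fin.last m)}

/-- The hyperplane `ℝⁿ⁻¹ ⊂ ℝⁿ`, where `n = m + 1`. -/
def baseHyperplane (m : ℕ) : Set (EuclideanSpace ℝ (Fin (m + 1))) :=
  {x | x (Fin.last m) = 0}

/-- The one-dimensional Hausdorff content: the infimum of `∑ diam (t i)` over all countable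
covers of `A`. -/
noncomputable def hausdorffContentOne {X : Type*} [PseudoEMetricSpace X] (A : Set X) : ℝ≥0∞ :=
  ⨅ (t : ℕ → Set X) (_ : A ⊆ ⋃ i, t i), ∑' i, Metric.ediam (t i)

/-- Nondegenerate closed cubes with sides parallel to the coordinate axes. -/
def IsClosedCube {n : ℕ} (Q : Set (EuclideanSpace ℝ (Fin n))) : Prop :=
  ∃ (a : EuclideanSpace ℝ (Fin n)) (s : ℝ), 0 < s ∧ Q = {x | ∀ i, a i ≤ x i ∧ x i ≤ a i + s}

/-- A Whitney decomposition of `Ω`: closed cubes with union `Ω` and pairwise disjoint interiors,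
with `diam Q ≤ dist (Q, Ωᶜ) ≤ 4 diam Q`. -/
structure IsWhitneyDecomposition {n : ℕ} (W : Set (Set (EuclideanSpace ℝ (Fin n))))
    (Ω : Set (EuclideanSpace ℝ (Fin n))) : Prop where
  isClosedCube : ∀ Q ∈ W, IsClosedCube Q
  sUnion_eq : ⋃₀ W = Ω
  disjoint_interior : W.Pairwise fun Q Q' => Disjoint (interior Q) (interior Q')
  diam_le_dist : ∀ Q ∈ W, Metric.ediam Q ≤ ⨅ x ∈ Q, Metric.infEDist x Ωᶜ
  dist_le_diam : ∀ Q ∈ W, ⨅ x ∈ Q, Metric.infEDist x Ωᶜ ≤ 4 * Metric.ediam Q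

/-- `Q₁` is a largest cube of the family `W`. -/
def IsLargestCube {n : ℕ} (W : Set (Set (EuclideanSpace ℝ (Fin n))))
    (Q₁ : Set (EuclideanSpace ℝ (Fin n))) : Prop :=
  Q₁ ∈ W ∧ ∀ Q ∈ W, Metric.ediam Q ≤ Metric.ediam Q₁

/-- The energy `∫_Ω |∇u|^p log^lam (e + |∇u|)`, with values in `[0, ∞]`. -/
noncomputable def logEnergy {n : ℕ} (p lam : ℝ) (Ω : Set (EuclideanSpace ℝ (Fin n)))
    (u : EuclideanSpace ℝ (Fin n) → ℝ) : ℝ≥0∞ :=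
  ∫⁻ x in Ω, ENNReal.ofReal
    (‖gradient u x‖ ^ p * Real.log (Real.exp 1 + ‖gradient u x‖) ^ lam)

/-- The conditions on a function `u` in the half ball of radius `r` that vanishes on `F`
and is large on average on a largest Whitney cube `Q₁`. -/
structure IsAdmissible (m : ℕ) (r : ℝ) (F : Set (EuclideanSpace ℝ (Fin (m + 1))))
    (W : Set (Set (EuclideanSpace ℝ (Fin (m + 1)))))
    (Q₁ : Set (EuclideanSpace ℝ (Fin (m + 1))))
    (u : EuclideanSpace ℝ (Fin (m + 1)) → ℝ) : Prop where
  subset : F ⊆ Metric.ball 0 r ∩ baseHyperplane m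
  isCompact : IsCompact F
  le_content : ENNReal.ofReal (r / 3) ≤ hausdorffContentOne F
  whitney : IsWhitneyDecomposition W (upperHalfBall m r)
  largest : IsLargestCube W Q₁
  contDiffOn : ContDiffOn ℝ 1 u (upperHalfBall m r)
  continuousOn : ContinuousOn u (upperHalfBall m r ∪ F)
  eq_zero : ∀ x ∈ F, u x = 0
  le_average : 1 / 2 ≤ ⨍ x in Q₁, u x

/-! Write `m = n - 1`, `g = |∇u|`, and `Φ(g)` for the energy density. Fix `x ∈ F`. The fundamental
theorem of calculus along the segments from `x` to the points of `Q₁`, averaged over `Q₁`, bounds a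
positive constant by the integral of `g(z) / z_n ^ m` over a cone with vertex `x`
(`IsAdmissible.le_lintegral_boundaryCone`).

Slices of the cone at height `t` have measure at most `(40 t) ^ m`, so the points where `g ≤ b(z_n)`
contribute little as soon as `∫₀^r b` is small. Where `g` exceeds the threshold, an inequality `A g
t ≤ t ^ m Φ(g)` at height `t` turns the remainder into a lower bound of order `A` for the integral
of `Φ / z_n` over the cone, at every `x ∈ F`.

These pointwise bounds are summed over `F` without a maximal function or a Frostman measure.
Integrals of `Φ` over dyadic regions, suitably normalized, are weights on dyadic cells whose sum
along the cells containing `x` is at least 1. Such a fractional cover bounds the content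
(`hausdorffContentOne_le_of_one_le_tsum`), and the regions overlap boundedly, so `A` times the
content of `F` is controlled by the energy (`mul_hausdorffContentOne_le_lintegral`). With content at
least `r / 3`, the energy is at least a constant times `A r` (`IsAdmissible.le_logEnergy`).

It remains to choose `b`. For `p > n - 1` a power `r ^ (-κ) t ^ (κ - 1)` gives `A ≈ r ^ (n - 1 - p)
log^λ(1/r)`. For `p = n - 1`, with `ℓ(t) = 1 - log t`, the threshold `ℓ(r) ^ κ t⁻¹ ℓ(t) ^ (-κ - 1)`
gives `A ≈ ℓ(r) ^ (λ - (n - 2))`. -/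

/-! ### Hausdorff content and fractional covers. -/

theorem hausdorffContentOne_le_tsum {X ι : Type*} [PseudoEMetricSpace X] [Countable ι] {A : Set X}
    (t : ι → Set X) (h : A ⊆ ⋃ i, t i) :
    hausdorffContentOne A ≤ ∑' i, Metric.ediam (t i) := by
  obtain ⟨e, he⟩ := Countable.exists_injective_nat ι
  have hcov : A ⊆ ⋃ k, Function.extend e t (fun _ => ∅) k := by
    refine h.trans (iUnion_subset fun i => ?_)
    refine subset_iUnion_of_subset (e i) ?_
    rw [he.extend_apply]
  refine (iInf₂_le (f := fun (t : ℕ → Set X) (_ : A ⊆ ⋃ i, t i) => ∑' i, Metric.ediam (t i))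
    _ hcov).trans_eq ?_
  rw [← tsum_extend_zero he]
  congr 1 with k
  by_cases hk : ∃ i, e i = k
  · obtain ⟨i, rfl⟩ := hk
    simp [he.extend_apply]
  · simp [Function.extend_apply' _ _ _ hk]

theorem volume_setOf_le_ofReal_lt_add_le (a b : ℝ≥0∞) :
    volume {θ : ℝ | 0 ≤ θ ∧ a ≤ ENNReal.ofReal θ ∧ ENNReal.ofReal θ < a + b} ≤ b := by
  induction b using ENNReal.recTopCoe with
  | top => exact le_top
  | coe b =>
    induction a using ENNReal.recTopCoe with
    | top => simp
    | coe a =>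
      have hsub : {θ : ℝ | 0 ≤ θ ∧ (a : ℝ≥0∞) ≤ ENNReal.ofReal θ ∧ ENNReal.ofReal θ < a + b}
          ⊆ Ico (a : ℝ) (a + b) := by
        rintro θ ⟨h0, h1, h2⟩
        lift θ to NNReal using h0
        rw [ENNReal.ofReal_coe_nnreal] at h1 h2
        norm_cast at h1 h2 
      refine (measure_mono hsub).trans ?_
      simp

/-- A fractional cover of `F` by the cells of a nested sequence of partitions bounds the content:
selecting the first cell at which the accumulated weight exceeds a threshold gives a cover, and
one averages over the threshold. -/
theorem hausdorffContentOne_le_of_one_le_tsum {X K : Type*} [PseudoEMetricSpace X] [Countable K]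
    {F : Set X} (κ : ℕ → X → K) (hκ : ∀ j x y, κ (j + 1) x = κ (j + 1) y → κ j x = κ j y)
    (w : ℕ → K → ℝ≥0∞) (hw : ∀ x ∈ F, 1 ≤ ∑' j, w j (κ j x)) :
    hausdorffContentOne F
      ≤ ∑' i : ℕ × K, Metric.ediam (κ i.1 ⁻¹' {i.2}) * w i.1 i.2 := by
  set S : ℕ → X → ℝ≥0∞ := fun j x => ∑ i ∈ Finset.range j, w i (κ i x) with hS
  have hκ' : ∀ j x y, κ j x = κ j y → ∀ i ≤ j, κ i x = κ i y := by
    intro j x y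
    induction j with
    | zero => intro h i hi; obtain rfl : i = 0 := by omega
              exact h
    | succ j ih =>
      intro h i hi
      rcases hi.lt_or_eq with hi | rfl
      · exact ih (hκ j x y h) i (by omega)
      · exact h
  have hSκ : ∀ j x y, κ j x = κ j y → S j x = S j y := by
    intro j x y h
    refine Finset.sum_congr rfl fun i hi => ?_
    rw [hκ' j x y h i (Finset.mem_range.1 hi).le]
  set T : ℝ → ℕ × K → Set X := fun θ i =>
    {x | κ i.1 x = i.2 ∧ S i.1 x ≤ ENNReal.ofReal θ ∧ ENNReal.ofReal θ < S (i.1 + 1) x} with hT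
  have hcov : ∀ θ ∈ Ico (0 : ℝ) 1, F ⊆ ⋃ i, T θ i := by
    intro θ hθ x hx
    have h1 : ENNReal.ofReal θ < ∑' j, w j (κ j x) :=
      lt_of_lt_of_le (by simpa using hθ.2) (hw x hx)
    rw [ENNReal.tsum_eq_iSup_nat, lt_iSup_iff] at h1
    classical
    have hN := Nat.find_spec h1
    set N := Nat.find h1
    have hN0 : N ≠ 0 := by
      intro h
      rw [h] at hN
      simp at hN
    obtain ⟨j, hj⟩ := Nat.exists_eq_succ_of_ne_zero hN0
    refine mem_iUnion.2 ⟨(j, κ j x), rfl, ?_, ?_⟩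
    · exact not_lt.1 (Nat.find_min h1 (m := j) (by change j < N; omega))
    · rw [hj] at hN
      exact hN
  -- Nestedness makes the partial sum `S j` constant on each cell of generation `j`, so the
  -- thresholds that select a given cell form an interval whose length is at most its weight.
  have hint : ∀ i : ℕ × K, ∃ I : Set ℝ, MeasurableSet I ∧ volume (I ∩ Ico 0 1) ≤ w i.1 i.2 ∧
      ∀ θ, Metric.ediam (T θ i) ≤ I.indicator (fun _ => Metric.ediam (κ i.1 ⁻¹' {i.2})) θ := by
    rintro ⟨j, k⟩
    by_cases hne : ∃ x, κ j x = k
    · obtain ⟨x₀, hx₀⟩ := hne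
      refine ⟨{θ | S j x₀ ≤ ENNReal.ofReal θ ∧ ENNReal.ofReal θ < S j x₀ + w j k}, ?_, ?_, ?_⟩
      · exact (measurableSet_le measurable_const ENNReal.measurable_ofReal).inter
          (measurableSet_lt ENNReal.measurable_ofReal measurable_const)
      · refine le_trans (measure_mono ?_) (volume_setOf_le_ofReal_lt_add_le (S j x₀) (w j k))
        rintro θ ⟨h1, h2⟩
        exact ⟨h2.1, h1⟩
      · intro θ
        rcases (T θ (j, k)).eq_empty_or_nonempty with h | ⟨x, hx1, hx2, hx3⟩
        · rw [h]; simp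
        · have hs : S (j + 1) x = S j x + w j k := by
            simp only [hS, Finset.sum_range_succ]
            simp only at hx1
            rw [hx1]
          have hs' : S j x = S j x₀ := hSκ j x x₀ (by rw [hx₀]; exact hx1)
          rw [indicator_of_mem]
          · exact Metric.ediam_mono fun y hy => hy.1
          · simp only at hx2 hx3
            rw [hs] at hx3
            rw [hs'] at hx2 hx3
            exact ⟨hx2, hx3⟩
    · refine ⟨∅, MeasurableSet.empty, by simp, fun θ => ?_⟩
      have : T θ (j, k) = ∅ := by
        ext x
        simp only [hT, mem_ofPred_eq, mem_empty_iff_false, iff_false]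
        exact fun h => hne ⟨x, h.1⟩
      rw [this]; simp
  choose I hIm hIv hId using hint
  calc hausdorffContentOne F = ∫⁻ _ in Ico (0 : ℝ) 1, hausdorffContentOne F := by simp
    _ ≤ ∫⁻ θ in Ico (0 : ℝ) 1,
          ∑' i, (I i).indicator (fun _ => Metric.ediam (κ i.1 ⁻¹' {i.2})) θ := by
        refine setLIntegral_mono' measurableSet_Ico fun θ hθ => ?_
        exact (hausdorffContentOne_le_tsum (T θ) (hcov θ hθ)).trans
          (ENNReal.tsum_le_tsum fun i => hId i θ)
    _ = ∑' i, ∫⁻ θ in Ico (0 : ℝ) 1,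
          (I i).indicator (fun _ => Metric.ediam (κ i.1 ⁻¹' {i.2})) θ :=
        lintegral_tsum fun i => (measurable_const.indicator (hIm i)).aemeasurable
    _ ≤ _ := by
        refine ENNReal.tsum_le_tsum fun i => ?_
        rw [lintegral_indicator_const (hIm i), Measure.restrict_apply (hIm i)]
        gcongr
        exact hIv i

/-! ### Nontangential cones, dyadic regions and the summation over `F`. -/

/-- The points of the half ball of radius `r` in the nontangential cone with vertex `x`. -/
def boundaryCone (m : ℕ) (r : ℝ) (x : EuclideanSpace ℝ (Fin (m + 1))) :
    Set (EuclideanSpace ℝ (Fin (m + 1))) :=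
  {z | z ∈ upperHalfBall m r ∧ dist z x ≤ 20 * z (Fin.last m)}

theorem isOpen_upperHalfBall (m : ℕ) (r : ℝ) : IsOpen (upperHalfBall m r) :=
  Metric.isOpen_ball.inter (isOpen_lt continuous_const (EuclideanSpace.proj (𝕜 := ℝ) (Fin.last m)).continuous)

theorem measurableSet_boundaryCone (m : ℕ) (r : ℝ) (x : EuclideanSpace ℝ (Fin (m + 1))) :
    MeasurableSet (boundaryCone m r x) :=
  (isOpen_upperHalfBall m r).measurableSet.inter
    (isClosed_le (continuous_id.dist continuous_const)
      (continuous_const.mul (EuclideanSpace.proj (𝕜 := ℝ) (Fin.last m)).continuous)).measurableSet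

theorem last_lt_of_mem_upperHalfBall {m : ℕ} {r : ℝ} {z : EuclideanSpace ℝ (Fin (m + 1))}
    (hz : z ∈ upperHalfBall m r) : z (Fin.last m) < r := by
  have h1 : ‖z‖ < r := by simpa using hz.1
  have h2 := PiLp.norm_apply_le z (Fin.last m)
  exact ((le_abs_self _).trans h2).trans_lt h1

/-- The index of the dyadic cell of generation `j` and side `r / 2 ^ j` that contains `x`. -/
noncomputable def dyadicIndex {n : ℕ} (r : ℝ) (j : ℕ) (x : EuclideanSpace ℝ (Fin n)) :
    Fin n → ℤ := fun i => ⌊2 ^ j * x i / r⌋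

theorem floor_le_floor_of_floor_two_mul_eq {a b : ℝ} (h : ⌊2 * a⌋ = ⌊2 * b⌋) : ⌊a⌋ ≤ ⌊b⌋ := by
  have h1 : 2 * ⌊a⌋ ≤ ⌊2 * a⌋ := Int.le_floor.2 (by push_cast; linarith [Int.floor_le a])
  rw [h, Int.le_floor] at h1
  refine Int.le_floor.2 ?_
  push_cast at h1
  linarith

theorem dyadicIndex_eq_of_succ {n : ℕ} (r : ℝ) (j : ℕ) (x y : EuclideanSpace ℝ (Fin n))
    (h : dyadicIndex r (j + 1) x = dyadicIndex r (j + 1) y) :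
    dyadicIndex r j x = dyadicIndex r j y := by
  ext i
  have hi := congrFun h i
  simp only [dyadicIndex] at hi ⊢
  have e : ∀ t : ℝ, 2 ^ (j + 1) * t / r = 2 * (2 ^ j * t / r) := fun t => by ring
  rw [e, e] at hi
  exact le_antisymm (floor_le_floor_of_floor_two_mul_eq hi)
    (floor_le_floor_of_floor_two_mul_eq hi.symm)

theorem EuclideanSpace.dist_le_card_mul {n : ℕ} {x y : EuclideanSpace ℝ (Fin n)} {s : ℝ}
    (hs : 0 ≤ s) (h : ∀ i, |x i - y i| ≤ s) : dist x y ≤ n * s := by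
  rw [EuclideanSpace.dist_eq]
  refine Real.sqrt_le_iff.2 ⟨by positivity, ?_⟩
  calc ∑ i, dist (x i) (y i) ^ 2 ≤ ∑ _i : Fin n, s ^ 2 := by
        refine Finset.sum_le_sum fun i _ => ?_
        rw [Real.dist_eq]
        exact pow_le_pow_left₀ (abs_nonneg _) (h i) 2
    _ = n * s ^ 2 := by simp
    _ ≤ (n * s) ^ 2 := by
        rw [mul_pow]
        gcongr
        exact_mod_cast Nat.le_self_pow two_ne_zero n

theorem ediam_dyadicIndex_preimage_le {n : ℕ} {r : ℝ} (hr : 0 < r) (j : ℕ) (k : Fin n → ℤ) :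
    Metric.ediam (dyadicIndex r j ⁻¹' {k}) ≤ ENNReal.ofReal (n * (r / 2 ^ j)) := by
  refine Metric.ediam_le fun x hx y hy => ?_
  rw [edist_dist]
  refine ENNReal.ofReal_le_ofReal (EuclideanSpace.dist_le_card_mul (by positivity) fun i => ?_)
  have h : ⌊2 ^ j * x i / r⌋ = ⌊2 ^ j * y i / r⌋ :=
    (congrFun (mem_singleton_iff.1 hx) i).trans (congrFun (mem_singleton_iff.1 hy) i).symm
  have h1 := (Int.abs_sub_lt_one_of_floor_eq_floor h).le
  have e : 2 ^ j * x i / r - 2 ^ j * y i / r = (x i - y i) / (r / 2 ^ j) := by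
    field_simp
  rw [e, abs_div, abs_of_pos (show 0 < r / 2 ^ j by positivity), div_le_one (by positivity)] at h1
  exact h1

/-- The points in the `j`-th dyadic layer of the half ball near the dyadic cell of index `k`. -/
def dyadicRegion (m : ℕ) (r : ℝ) (j : ℕ) (k : Fin (m + 1) → ℤ) :
    Set (EuclideanSpace ℝ (Fin (m + 1))) :=
  {z | z ∈ upperHalfBall m r ∧ z (Fin.last m) ∈ Ioc (r / 2 ^ (j + 1)) (r / 2 ^ j) ∧
    ∀ i, |2 ^ j * z i / r - k i| ≤ 21}

theorem measurableSet_dyadicRegion (m : ℕ) (r : ℝ) (j : ℕ) (k : Fin (m + 1) → ℤ) :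
    MeasurableSet (dyadicRegion m r j k) := by
  refine (isOpen_upperHalfBall m r).measurableSet.inter (MeasurableSet.inter ?_ ?_)
  · exact measurableSet_Ioc.preimage (by fun_prop)
  · have : {z : EuclideanSpace ℝ (Fin (m + 1)) | ∀ i, |2 ^ j * z i / r - k i| ≤ 21}
        = ⋂ i, {z | |2 ^ j * z i / r - k i| ≤ 21} := by ext; simp
    change MeasurableSet {z : EuclideanSpace ℝ (Fin (m + 1)) | ∀ i, |2 ^ j * z i / r - k i| ≤ 21}
    rw [this]
    exact MeasurableSet.iInter fun i => (isClosed_le (by fun_prop) (by fun_prop)).measurableSet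

theorem boundaryCone_subset_iUnion_dyadicRegion {m : ℕ} {r : ℝ} (hr : 0 < r)
    (x : EuclideanSpace ℝ (Fin (m + 1))) :
    boundaryCone m r x ⊆ ⋃ j, dyadicRegion m r j (dyadicIndex r j x) := by
  rintro z ⟨hz, hzx⟩
  have hz0 : 0 < z (Fin.last m) := hz.2
  have hzr := last_lt_of_mem_upperHalfBall hz
  obtain ⟨j, hj1, hj2⟩ := exists_nat_pow_near (x := r / z (Fin.last m)) (y := 2)
    ((one_le_div hz0).2 hzr.le) one_lt_two
  have hj3 : z (Fin.last m) ≤ r / 2 ^ j := by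
    rw [le_div_iff₀ hz0] at hj1
    rw [le_div_iff₀ (by positivity)]
    linarith
  refine mem_iUnion.2 ⟨j, hz, ⟨?_, hj3⟩, fun i => ?_⟩
  · rw [div_lt_iff₀ hz0] at hj2
    rw [div_lt_iff₀ (by positivity)]
    linarith
  · have h1 : |z i - x i| ≤ dist z x := by
      rw [dist_eq_norm]
      exact PiLp.norm_apply_le (z - x) i
    have h2 : |z i - x i| ≤ 20 * (r / 2 ^ j) := by linarith
    have e : 2 ^ j * z i / r - 2 ^ j * x i / r = (z i - x i) / (r / 2 ^ j) := by
      field_simp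
    have h3 : |2 ^ j * z i / r - 2 ^ j * x i / r| ≤ 20 := by
      rw [e, abs_div, abs_of_pos (show 0 < r / 2 ^ j by positivity), div_le_iff₀ (by positivity)]
      exact h2
    -- Rounding `x` down to its index costs at most 1, hence 21 instead of the aperture 20.
    have h4 := Int.floor_le (2 ^ j * x i / r)
    have h5 := Int.lt_floor_add_one (2 ^ j * x i / r)
    simp only [dyadicIndex]
    rw [abs_le] at h3 ⊢
    constructor <;> linarith [h3.1, h3.2]

/-- Bounded overlap: the layers are disjoint in height, and each coordinate of an admissible index
is an integer in an interval of length 42, which leaves at most 43 choices. -/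
theorem tsum_indicator_dyadicRegion_le {m : ℕ} {r : ℝ} (hr : 0 < r)
    (f : EuclideanSpace ℝ (Fin (m + 1)) → ℝ≥0∞) (z : EuclideanSpace ℝ (Fin (m + 1))) :
    ∑' i : ℕ × (Fin (m + 1) → ℤ), (dyadicRegion m r i.1 i.2).indicator f z
      ≤ 43 ^ (m + 1) * (upperHalfBall m r).indicator f z := by
  by_cases h : ∃ i : ℕ × (Fin (m + 1) → ℤ), z ∈ dyadicRegion m r i.1 i.2
  · obtain ⟨⟨j, k⟩, hjk⟩ := h
    simp only at hjk
    rw [indicator_of_mem hjk.1]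
    classical
    let s : Finset (ℕ × (Fin (m + 1) → ℤ)) := {j} ×ˢ Fintype.piFinset fun i =>
      Finset.Icc ⌈2 ^ j * z i / r - 21⌉ ⌊2 ^ j * z i / r + 21⌋
    have hs : ∀ i ∉ s, (dyadicRegion m r i.1 i.2).indicator f z = 0 := by
      rintro ⟨j', k'⟩ hi
      refine indicator_of_notMem (fun hz => hi ?_) _
      have hlt : ∀ a b : ℕ, z (Fin.last m) ∈ Ioc (r / 2 ^ (a + 1)) (r / 2 ^ a) →
          z (Fin.last m) ∈ Ioc (r / 2 ^ (b + 1)) (r / 2 ^ b) → b ≤ a := by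
        intro a b ha hb
        by_contra! hab
        have : r / 2 ^ b ≤ r / 2 ^ (a + 1) := by
          gcongr
          · exact one_le_two
          · exact hab
        linarith [ha.1, hb.2]
      have hj : j' = j := le_antisymm (hlt _ _ hjk.2.1 hz.2.1) (hlt _ _ hz.2.1 hjk.2.1)
      subst hj
      refine Finset.mem_product.2 ⟨Finset.mem_singleton_self _, Fintype.mem_piFinset.2 fun i => ?_⟩
      have := abs_le.1 (hz.2.2 i)
      refine Finset.mem_Icc.2 ⟨Int.ceil_le.2 ?_, Int.le_floor.2 ?_⟩ <;> simp only at this ⊢ <;>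
        linarith [this.1, this.2]
    rw [tsum_eq_sum hs]
    have hcard : s.card ≤ 43 ^ (m + 1) := by
      rw [Finset.card_product, Finset.card_singleton, one_mul, Fintype.card_piFinset]
      refine (Finset.prod_le_pow_card _ _ 43 fun i _ => ?_).trans_eq (by simp)
      rw [Int.card_Icc, Int.toNat_le]
      have h1 := Int.floor_le (2 ^ j * z i / r + 21)
      have h2 := Int.le_ceil (2 ^ j * z i / r - 21)
      have h3 : ⌊2 ^ j * z i / r + 21⌋ ≤ ⌈2 ^ j * z i / r - 21⌉ + 42 := by
        have : (⌊2 ^ j * z i / r + 21⌋ : ℝ) ≤ ((⌈2 ^ j * z i / r - 21⌉ + 42 : ℤ) : ℝ) := by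
          push_cast
          linarith
        exact Int.cast_le.1 this
      push_cast
      omega
    calc ∑ i ∈ s, (dyadicRegion m r i.1 i.2).indicator f z ≤ ∑ _i ∈ s, f z :=
          Finset.sum_le_sum fun i _ => indicator_le_self' (fun _ _ => zero_le) _
      _ = s.card * f z := by simp
      _ ≤ 43 ^ (m + 1) * f z := by
          gcongr
          exact_mod_cast hcard
  · push Not at h
    simp [indicator_of_notMem (h _)]

theorem tsum_lintegral_dyadicRegion_le {m : ℕ} {r : ℝ} (hr : 0 < r)
    {f : EuclideanSpace ℝ (Fin (m + 1)) → ℝ≥0∞} (hf : Measurable f) :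
    ∑' i : ℕ × (Fin (m + 1) → ℤ), ∫⁻ z in dyadicRegion m r i.1 i.2, f z
      ≤ 43 ^ (m + 1) * ∫⁻ z in upperHalfBall m r, f z := by
  have hm : ∀ i : ℕ × (Fin (m + 1) → ℤ),
      AEMeasurable ((dyadicRegion m r i.1 i.2).indicator f) volume := fun i =>
    (hf.indicator (measurableSet_dyadicRegion m r i.1 i.2)).aemeasurable
  have h1 : ∀ i : ℕ × (Fin (m + 1) → ℤ), ∫⁻ z in dyadicRegion m r i.1 i.2, f z
      = ∫⁻ z, (dyadicRegion m r i.1 i.2).indicator f z := fun i =>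
    (lintegral_indicator (measurableSet_dyadicRegion m r i.1 i.2) f).symm
  simp_rw [h1]
  rw [← lintegral_tsum hm, ← lintegral_indicator (isOpen_upperHalfBall m r).measurableSet,
    ← lintegral_const_mul _ (hf.indicator (isOpen_upperHalfBall m r).measurableSet)]
  exact lintegral_mono fun z => tsum_indicator_dyadicRegion_le hr f z

/-- If the integral of `f z / z_last` over the nontangential cone at every point of `F` is at
least `A`, then the integral of `f` controls `A` times the content of `F`. -/
theorem mul_hausdorffContentOne_le_lintegral {m : ℕ} {r : ℝ} (hr : 0 < r)
    {F : Set (EuclideanSpace ℝ (Fin (m + 1)))} {f : EuclideanSpace ℝ (Fin (m + 1)) → ℝ≥0∞}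
    (hf : Measurable f) {A : ℝ≥0∞} (hA : A ≠ ⊤)
    (hF : ∀ x ∈ F, A ≤ ∫⁻ z in boundaryCone m r x, f z / ENNReal.ofReal (z (Fin.last m))) :
    A * hausdorffContentOne F
      ≤ ENNReal.ofReal (2 * (m + 1) * 43 ^ (m + 1)) * ∫⁻ z in upperHalfBall m r, f z := by
  rcases eq_or_ne A 0 with rfl | hA0
  · simp
  set I : ℕ → (Fin (m + 1) → ℤ) → ℝ≥0∞ := fun j k => ∫⁻ z in dyadicRegion m r j k, f z with hI
  -- In layer `j` the factor `1 / z_last` is at most `2 ^ (j + 1) / r`; dividing by `A` normalizes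
  -- the sum of the weights to at least 1.
  have hw : ∀ x ∈ F, 1 ≤ ∑' j, A⁻¹ * (ENNReal.ofReal (2 ^ (j + 1) / r) *
      I j (dyadicIndex r j x)) := by
    intro x hx
    rw [ENNReal.tsum_mul_left, ← ENNReal.inv_mul_cancel hA0 hA]
    gcongr
    calc A ≤ ∫⁻ z in boundaryCone m r x, f z / ENNReal.ofReal (z (Fin.last m)) := hF x hx
      _ ≤ ∫⁻ z in ⋃ j, dyadicRegion m r j (dyadicIndex r j x),
            f z / ENNReal.ofReal (z (Fin.last m)) :=
          lintegral_mono_set (boundaryCone_subset_iUnion_dyadicRegion hr x)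
      _ ≤ ∑' j, ∫⁻ z in dyadicRegion m r j (dyadicIndex r j x),
            f z / ENNReal.ofReal (z (Fin.last m)) := lintegral_iUnion_le _ _
      _ ≤ _ := by
          refine ENNReal.tsum_le_tsum fun j => ?_
          rw [hI, ← lintegral_const_mul _ hf]
          refine setLIntegral_mono' (measurableSet_dyadicRegion _ _ _ _) fun z hz => ?_
          rw [ENNReal.div_eq_inv_mul]
          gcongr
          rw [← ENNReal.ofReal_inv_of_pos hz.1.2]
          refine ENNReal.ofReal_le_ofReal ?_
          rw [inv_le_comm₀ hz.1.2 (by positivity), inv_div]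
          exact hz.2.1.1.le
  have hmain := hausdorffContentOne_le_of_one_le_tsum (dyadicIndex r) (dyadicIndex_eq_of_succ r)
    (fun j k => A⁻¹ * (ENNReal.ofReal (2 ^ (j + 1) / r) * I j k)) hw
  calc A * hausdorffContentOne F
      ≤ A * ∑' i : ℕ × (Fin (m + 1) → ℤ), A⁻¹ * (ENNReal.ofReal (2 * (m + 1)) * I i.1 i.2) := by
        gcongr
        refine hmain.trans (ENNReal.tsum_le_tsum fun i => ?_)
        -- The diameter of a cell and the factor in its weight are inverse in scale, so the product
        -- no longer depends on the generation. This is where the dimension one of the content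
        -- enters.
        calc _ ≤ ENNReal.ofReal ((m + 1 : ℕ) * (r / 2 ^ i.1)) *
                (A⁻¹ * (ENNReal.ofReal (2 ^ (i.1 + 1) / r) * I i.1 i.2)) := by
              gcongr
              exact ediam_dyadicIndex_preimage_le hr _ _
          _ = A⁻¹ * (ENNReal.ofReal ((m + 1 : ℕ) * (r / 2 ^ i.1)) *
                ENNReal.ofReal (2 ^ (i.1 + 1) / r) * I i.1 i.2) := by ring
          _ = _ := by
              rw [← ENNReal.ofReal_mul (by positivity), mul_assoc]
              congr 3
              push_cast
              field_simp
              ring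
    _ = ENNReal.ofReal (2 * (m + 1)) * ∑' i : ℕ × (Fin (m + 1) → ℤ), I i.1 i.2 := by
        rw [ENNReal.tsum_mul_left, ← mul_assoc, ENNReal.mul_inv_cancel hA0 hA, one_mul,
          ENNReal.tsum_mul_left]
    _ ≤ ENNReal.ofReal (2 * (m + 1)) * (43 ^ (m + 1) * ∫⁻ z in upperHalfBall m r, f z) := by
        gcongr
        exact tsum_lintegral_dyadicRegion_le hr hf
    _ = _ := by
        rw [← mul_assoc, ENNReal.ofReal_mul (p := 2 * ((m : ℝ) + 1)) (by positivity),
          ENNReal.ofReal_pow (by positivity)]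
        norm_num

/-- Fubini's theorem on the nontangential cone, whose slice at height `t` has measure at most
`(40 t) ^ m`. -/
theorem lintegral_boundaryCone_le {m : ℕ} {r : ℝ} (x : EuclideanSpace ℝ (Fin (m + 1)))
    {b : ℝ → ℝ≥0∞} (hb : Measurable b) :
    ∫⁻ z in boundaryCone m r x, b (z (Fin.last m)) / ENNReal.ofReal (z (Fin.last m)) ^ m
      ≤ ENNReal.ofReal (40 ^ m) * ∫⁻ t in Ioo 0 r, b t := by
  set e : EuclideanSpace ℝ (Fin (m + 1)) → ℝ × (Fin m → ℝ) := fun z =>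
    MeasurableEquiv.piFinSuccAbove (fun _ => ℝ) (Fin.last m)
      ((MeasurableEquiv.toLp 2 (Fin (m + 1) → ℝ)).symm z) with he
  have hemp : MeasurePreserving e :=
    (volume_preserving_piFinSuccAbove (fun _ => ℝ) (Fin.last m)).comp
      (EuclideanSpace.volume_preserving_symm_measurableEquiv_toLp (Fin (m + 1)))
  have he1 : ∀ z, (e z).1 = z (Fin.last m) := fun z => rfl
  have he2 : ∀ z i, (e z).2 i = z ((Fin.last m).succAbove i) := fun z i => rfl
  set D : Set (ℝ × (Fin m → ℝ)) := {p | p.1 ∈ Ioo 0 r ∧ ∀ i, |p.2 i - (e x).2 i| ≤ 20 * p.1}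
    with hD
  have hDm : MeasurableSet D := by
    refine (measurableSet_Ioo.preimage measurable_fst).inter ?_
    change MeasurableSet {p : ℝ × (Fin m → ℝ) | ∀ i, |p.2 i - (e x).2 i| ≤ 20 * p.1}
    simp only [ofPred_forall]
    refine MeasurableSet.iInter fun i => (isClosed_le ?_ ?_).measurableSet <;> fun_prop
  set H : ℝ × (Fin m → ℝ) → ℝ≥0∞ := D.indicator fun p => b p.1 / ENNReal.ofReal p.1 ^ m with hH
  have hHm : Measurable H := by
    refine Measurable.indicator ?_ hDm
    exact (hb.comp measurable_fst).div ((ENNReal.measurable_ofReal.comp measurable_fst).pow_const m)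
  have hsub : ∀ z ∈ boundaryCone m r x, e z ∈ D := by
    rintro z ⟨hz, hzx⟩
    refine ⟨⟨hz.2, last_lt_of_mem_upperHalfBall hz⟩, fun i => ?_⟩
    rw [he2, he2, he1]
    refine le_trans ?_ hzx
    rw [dist_eq_norm]
    exact PiLp.norm_apply_le (z - x) _
  calc ∫⁻ z in boundaryCone m r x, b (z (Fin.last m)) / ENNReal.ofReal (z (Fin.last m)) ^ m
      ≤ ∫⁻ z in boundaryCone m r x, H (e z) := by
        refine setLIntegral_mono' (measurableSet_boundaryCone m r x) fun z hz => ?_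
        rw [hH, indicator_of_mem (hsub z hz), he1]
    _ ≤ ∫⁻ z, H (e z) := setLIntegral_le_lintegral _ _
    _ = ∫⁻ p, H p := hemp.lintegral_comp hHm
    _ = ∫⁻ t, ∫⁻ y, H (t, y) := lintegral_prod _ hHm.aemeasurable
    _ ≤ ∫⁻ t, (Ioo 0 r).indicator (fun t => ENNReal.ofReal (40 ^ m) * b t) t := by
        refine lintegral_mono fun t => ?_
        by_cases ht : t ∈ Ioo 0 r
        · rw [indicator_of_mem ht]
          have ht0 : 0 < t := ht.1
          calc ∫⁻ y, H (t, y)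
              ≤ ∫⁻ y, (Icc (fun i => (e x).2 i - 20 * t) (fun i => (e x).2 i + 20 * t)).indicator
                  (fun _ => b t / ENNReal.ofReal t ^ m) y := by
                refine lintegral_mono fun y => ?_
                by_cases hy : (t, y) ∈ D
                · rw [indicator_of_mem, hH, indicator_of_mem hy]
                  exact ⟨fun i => by linarith [(abs_le.1 (hy.2 i)).1],
                    fun i => by linarith [(abs_le.1 (hy.2 i)).2]⟩
                · rw [hH, indicator_of_notMem hy]
                  exact zero_le
            _ = b t / ENNReal.ofReal t ^ m * ENNReal.ofReal (40 * t) ^ m := by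
                rw [lintegral_indicator_const measurableSet_Icc, Real.volume_Icc_pi]
                congr 1
                rw [Finset.prod_congr rfl (g := fun _ => ENNReal.ofReal (40 * t))
                  (fun i _ => by congr 1; ring)]
                simp
            _ = ENNReal.ofReal (40 ^ m) * b t := by
                rw [ENNReal.ofReal_mul (by norm_num), mul_pow, ENNReal.ofReal_pow (by norm_num),
                  ENNReal.div_eq_inv_mul, mul_comm (_⁻¹), mul_comm (_ ^ m) (_ ^ m), mul_assoc,
                  ← mul_assoc (_⁻¹), ENNReal.inv_mul_cancel, one_mul, mul_comm]
                · exact pow_ne_zero _ (by simpa using ht0)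
                · exact ENNReal.pow_ne_top ENNReal.ofReal_ne_top
        · have : ∀ y, H (t, y) = 0 := fun y => indicator_of_notMem (fun h => ht h.1) _
          simp [this]
    _ = ENNReal.ofReal (40 ^ m) * ∫⁻ t in Ioo 0 r, b t := by
        rw [lintegral_indicator measurableSet_Ioo, lintegral_const_mul _ hb]

/-! ### Size and position of the largest Whitney cube. -/

theorem ofReal_le_infEDist_compl_upperHalfBall {m : ℕ} {r : ℝ} (hr : 0 < r) :
    ENNReal.ofReal (r / 2) ≤ Metric.infEDist
      (EuclideanSpace.single (Fin.last m) (r / 2)) (upperHalfBall m r)ᶜ := by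
  refine Metric.le_infEDist.2 fun q hq => ?_
  rw [edist_dist]
  refine ENNReal.ofReal_le_ofReal ?_
  by_contra! h
  refine hq ⟨?_, ?_⟩
  · rw [mem_ball_zero_iff]
    have h1 := norm_le_norm_add_norm_sub' q (EuclideanSpace.single (Fin.last m) (r / 2))
    rw [PiLp.norm_single, Real.norm_of_nonneg (by positivity), ← dist_eq_norm, dist_comm] at h1
    linarith
  · have h1 := PiLp.norm_apply_le (EuclideanSpace.single (Fin.last m) (r / 2) - q) (Fin.last m)
    rw [← dist_eq_norm] at h1
    have h2 : |r / 2 - q (Fin.last m)| < r / 2 := by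
      refine lt_of_le_of_lt ?_ h
      simpa using h1
    linarith [(abs_lt.1 h2).2]

theorem infEDist_compl_upperHalfBall_le {m : ℕ} {r : ℝ} (y : EuclideanSpace ℝ (Fin (m + 1)))
    (hy : y ∈ upperHalfBall m r) :
    Metric.infEDist y (upperHalfBall m r)ᶜ ≤ ENNReal.ofReal (y (Fin.last m)) := by
  have hmem : y - EuclideanSpace.single (Fin.last m) (y (Fin.last m)) ∈ (upperHalfBall m r)ᶜ := by
    intro h
    have := h.2
    simp at this
  refine (Metric.infEDist_le_edist_of_mem hmem).trans ?_
  rw [edist_dist, dist_eq_norm, sub_sub_cancel, PiLp.norm_single, Real.norm_of_nonneg hy.2.le]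

/-- The point at height `r / 2` on the axis is at distance at least `r / 2` from the complement and
lies in some cube `Q`; the Whitney condition makes that distance at most `4 diam Q + diam Q`. -/
theorem IsWhitneyDecomposition.le_ediam_of_isLargestCube {m : ℕ} {r : ℝ} (hr : 0 < r)
    {W : Set (Set (EuclideanSpace ℝ (Fin (m + 1))))} {Q₁ : Set (EuclideanSpace ℝ (Fin (m + 1)))}
    (hW : IsWhitneyDecomposition W (upperHalfBall m r)) (hQ : IsLargestCube W Q₁) :
    ENNReal.ofReal (r / 10) ≤ Metric.ediam Q₁ := by
  set p : EuclideanSpace ℝ (Fin (m + 1)) := EuclideanSpace.single (Fin.last m) (r / 2) with hp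
  have hpΩ : p ∈ upperHalfBall m r := by
    refine ⟨?_, ?_⟩
    · rw [mem_ball_zero_iff, hp, PiLp.norm_single, Real.norm_of_nonneg (by positivity)]
      linarith
    · simp [hp, hr]
  rw [← hW.sUnion_eq] at hpΩ
  obtain ⟨Q, hQW, hpQ⟩ := hpΩ
  have h1 : Metric.infEDist p (upperHalfBall m r)ᶜ
      ≤ (⨅ x ∈ Q, Metric.infEDist x (upperHalfBall m r)ᶜ) + Metric.ediam Q := by
    simp only [ENNReal.iInf_add]
    refine le_iInf₂ fun x hx => ?_
    refine (Metric.infEDist_le_infEDist_add_edist (y := x)).trans ?_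
    gcongr
    exact Metric.edist_le_ediam_of_mem hpQ hx
  have h2 : ENNReal.ofReal (r / 2) ≤ 5 * Metric.ediam Q₁ :=
    calc ENNReal.ofReal (r / 2) ≤ _ := ofReal_le_infEDist_compl_upperHalfBall hr
      _ ≤ _ := h1
      _ ≤ 4 * Metric.ediam Q + Metric.ediam Q := by
          gcongr
          exact hW.dist_le_diam Q hQW
      _ = 5 * Metric.ediam Q := by ring
      _ ≤ _ := by
          exact mul_le_mul_right (hQ.2 Q hQW) 5
  have h3 : ENNReal.ofReal (r / 2) = 5 * ENNReal.ofReal (r / 10) := by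
    rw [show r / 2 = 5 * (r / 10) by ring, ENNReal.ofReal_mul (by norm_num)]
    norm_num
  rw [h3] at h2
  exact (ENNReal.mul_le_mul_iff_right (by norm_num) (by norm_num)).1 h2

theorem IsAdmissible.div_ten_le_last {m : ℕ} {r : ℝ} (hr : 0 < r)
    {F : Set (EuclideanSpace ℝ (Fin (m + 1)))} {W : Set (Set (EuclideanSpace ℝ (Fin (m + 1))))}
    {Q₁ : Set (EuclideanSpace ℝ (Fin (m + 1)))} {u : EuclideanSpace ℝ (Fin (m + 1)) → ℝ}
    (h : IsAdmissible m r F W Q₁ u) {y : EuclideanSpace ℝ (Fin (m + 1))} (hy : y ∈ Q₁) :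
    y ∈ upperHalfBall m r ∧ r / 10 ≤ y (Fin.last m) := by
  have hyΩ : y ∈ upperHalfBall m r := by
    rw [← h.whitney.sUnion_eq]
    exact ⟨Q₁, h.largest.1, hy⟩
  refine ⟨hyΩ, ?_⟩
  have h1 : ENNReal.ofReal (r / 10) ≤ ENNReal.ofReal (y (Fin.last m)) :=
    calc _ ≤ Metric.ediam Q₁ := h.whitney.le_ediam_of_isLargestCube hr h.largest
      _ ≤ ⨅ x ∈ Q₁, Metric.infEDist x (upperHalfBall m r)ᶜ := h.whitney.diam_le_dist _ h.largest.1
      _ ≤ Metric.infEDist y (upperHalfBall m r)ᶜ := iInf₂_le y hy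
      _ ≤ _ := infEDist_compl_upperHalfBall_le y hyΩ
  exact (ENNReal.ofReal_le_ofReal_iff hyΩ.2.le).1 h1

theorem IsAdmissible.exists_cube {m : ℕ} {r : ℝ} (hr : 0 < r)
    {F : Set (EuclideanSpace ℝ (Fin (m + 1)))} {W : Set (Set (EuclideanSpace ℝ (Fin (m + 1))))}
    {Q₁ : Set (EuclideanSpace ℝ (Fin (m + 1)))} {u : EuclideanSpace ℝ (Fin (m + 1)) → ℝ}
    (h : IsAdmissible m r F W Q₁ u) :
    MeasurableSet Q₁ ∧ ∃ s : ℝ, r / (10 * (m + 1)) ≤ s ∧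
      volume Q₁ = ENNReal.ofReal (s ^ (m + 1)) := by
  obtain ⟨a, s, hs, hQ⟩ := h.whitney.isClosedCube Q₁ h.largest.1
  have hQ' : Q₁ = (MeasurableEquiv.toLp 2 (Fin (m + 1) → ℝ)).symm ⁻¹'
      Icc (fun i => a i) (fun i => a i + s) := by
    rw [hQ]
    ext y
    exact ⟨fun hy => ⟨fun i => (hy i).1, fun i => (hy i).2⟩, fun hy i => ⟨hy.1 i, hy.2 i⟩⟩
  have hm : MeasurableSet Q₁ := by
    rw [hQ']
    exact measurableSet_Icc.preimage (MeasurableEquiv.measurable _)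
  refine ⟨hm, s, ?_, ?_⟩
  · have h1 := h.whitney.le_ediam_of_isLargestCube hr h.largest
    have h2 : Metric.ediam Q₁ ≤ ENNReal.ofReal ((m + 1 : ℕ) * s) := by
      refine Metric.ediam_le fun y hy y' hy' => ?_
      rw [hQ] at hy hy'
      rw [edist_dist]
      refine ENNReal.ofReal_le_ofReal (EuclideanSpace.dist_le_card_mul hs.le fun i => ?_)
      rw [abs_le]
      constructor <;> linarith [(hy i).1, (hy i).2, (hy' i).1, (hy' i).2]
    have h3 := (ENNReal.ofReal_le_ofReal_iff (by positivity)).1 (h1.trans h2)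
    push_cast at h3
    rw [div_le_iff₀ (by positivity)] at h3 ⊢
    linarith
  · rw [hQ', (EuclideanSpace.volume_preserving_symm_measurableEquiv_toLp
      (Fin (m + 1))).measure_preimage measurableSet_Icc.nullMeasurableSet, Real.volume_Icc_pi,
      ENNReal.ofReal_pow hs.le]
    simp

/-! ### The potential estimate at a zero of `u`. -/

theorem add_smul_sub_mem_upperHalfBall {m : ℕ} {r : ℝ} {x y : EuclideanSpace ℝ (Fin (m + 1))}
    (hx : x ∈ Metric.ball 0 r ∩ baseHyperplane m) (hy : y ∈ upperHalfBall m r) {t : ℝ}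
    (ht : t ∈ Ioc 0 1) : x + t • (y - x) ∈ upperHalfBall m r := by
  refine ⟨(convex_ball 0 r).add_smul_sub_mem hx.1 hy.1 ⟨ht.1.le, ht.2⟩, ?_⟩
  have hx0 : x (Fin.last m) = 0 := hx.2
  have : (x + t • (y - x)) (Fin.last m) = t * y (Fin.last m) := by simp [hx0]
  rw [this]
  exact mul_pos ht.1 hy.2

theorem norm_gradient_eq {n : ℕ} (u : EuclideanSpace ℝ (Fin n) → ℝ)
    (z : EuclideanSpace ℝ (Fin n)) : ‖gradient u z‖ = ‖fderiv ℝ u z‖ := by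
  simp [gradient]

theorem measurable_norm_gradient {n : ℕ} (u : EuclideanSpace ℝ (Fin n) → ℝ) :
    Measurable fun z => ‖gradient u z‖ := by
  simp only [norm_gradient_eq]
  exact (measurable_fderiv ℝ u).norm

/-- The fundamental theorem of calculus on the segment from a boundary point `x ∈ F` to `y`. -/
theorem IsAdmissible.enorm_le_lintegral {m : ℕ} {r : ℝ}
    {F : Set (EuclideanSpace ℝ (Fin (m + 1)))} {W : Set (Set (EuclideanSpace ℝ (Fin (m + 1))))}
    {Q₁ : Set (EuclideanSpace ℝ (Fin (m + 1)))} {u : EuclideanSpace ℝ (Fin (m + 1)) → ℝ}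
    (h : IsAdmissible m r F W Q₁ u) {x y : EuclideanSpace ℝ (Fin (m + 1))} (hx : x ∈ F)
    (hy : y ∈ upperHalfBall m r) :
    ‖u y‖ₑ ≤ ENNReal.ofReal (2 * r) *
      ∫⁻ t in Ioo (0 : ℝ) 1, ENNReal.ofReal ‖gradient u (x + t • (y - x))‖ := by
  have hxB := h.subset hx
  have hmem : ∀ t ∈ Ioc (0 : ℝ) 1, x + t • (y - x) ∈ upperHalfBall m r := fun t ht =>
    add_smul_sub_mem_upperHalfBall hxB hy ht
  set φ : ℝ → ℝ := fun t => u (x + t • (y - x)) with hφ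
  have hγ : ContDiff ℝ 1 fun t : ℝ => x + t • (y - x) := by fun_prop
  have hdist : ‖y - x‖ ≤ 2 * r := by
    have h1 := norm_sub_le y x
    have h2 := mem_ball_zero_iff.1 hxB.1
    have h3 := mem_ball_zero_iff.1 hy.1
    linarith
  -- `u` is only continuous at `x`, so the segment is cut off at `ε`, and `ε → 0` afterwards.
  have hbound : ∀ ε ∈ Ioo (0 : ℝ) 1, ‖φ 1 - φ ε‖ₑ ≤ ENNReal.ofReal (2 * r) *
      ∫⁻ t in Ioo (0 : ℝ) 1, ENNReal.ofReal ‖gradient u (x + t • (y - x))‖ := by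
    intro ε hε
    have hc : ContDiffOn ℝ 1 φ (Icc ε 1) := h.contDiffOn.comp hγ.contDiffOn
      fun t ht => hmem t ⟨hε.1.trans_le ht.1, ht.2⟩
    refine (enorm_sub_le_lintegral_deriv_of_contDiffOn_Icc hc hε.2.le).trans ?_
    rw [← lintegral_const_mul' _ _ ENNReal.ofReal_ne_top, ← restrict_Ioo_eq_restrict_Icc]
    refine (lintegral_mono_set (Ioo_subset_Ioo_left hε.1.le)).trans ?_
    refine setLIntegral_mono' measurableSet_Ioo fun t ht => ?_
    have hz := hmem t ⟨ht.1, ht.2.le⟩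
    have hd : HasDerivAt φ (fderiv ℝ u (x + t • (y - x)) (y - x)) t := by
      have h1 : HasFDerivAt u (fderiv ℝ u (x + t • (y - x))) (x + t • (y - x)) :=
        ((h.contDiffOn _ hz).contDiffAt
          ((isOpen_upperHalfBall m r).mem_nhds hz)).differentiableAt one_ne_zero |>.hasFDerivAt
      have h2 : HasDerivAt (fun t : ℝ => x + t • (y - x)) (y - x) t := by
        simpa using ((hasDerivAt_id t).smul_const (y - x)).const_add x
      exact h1.comp_hasDerivAt t h2
    rw [hd.deriv, ← ENNReal.ofReal_mul (by linarith [norm_nonneg (y - x)]), ← ofReal_norm]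
    refine ENNReal.ofReal_le_ofReal ?_
    rw [norm_gradient_eq, mul_comm]
    exact ((fderiv ℝ u (x + t • (y - x))).le_opNorm _).trans (by gcongr)
  have hlim : Filter.Tendsto φ (nhdsWithin 0 (Ioo 0 1)) (nhds 0) := by
    have h1 : ContinuousWithinAt u (upperHalfBall m r ∪ F) x := h.continuousOn x (Or.inr hx)
    have h2 : Filter.Tendsto (fun t : ℝ => x + t • (y - x)) (nhdsWithin 0 (Ioo 0 1))
        (nhdsWithin x (upperHalfBall m r ∪ F)) := by
      refine tendsto_nhdsWithin_iff.2 ⟨?_, ?_⟩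
      · have := (hγ.continuous.tendsto 0).mono_left (nhdsWithin_le_nhds (s := Ioo 0 1))
        simpa using this
      · filter_upwards [self_mem_nhdsWithin] with t ht
        exact Or.inl (hmem t ⟨ht.1, ht.2.le⟩)
    have h3 := h1.tendsto.comp h2
    rwa [h.eq_zero x hx] at h3
  have hlim' : Filter.Tendsto (fun ε => ‖φ 1 - φ ε‖ₑ) (nhdsWithin 0 (Ioo 0 1))
      (nhds ‖u y‖ₑ) := by
    have h1 := ((tendsto_const_nhds (x := φ 1)).sub hlim).enorm
    simpa [hφ] using h1
  have : (nhdsWithin (0 : ℝ) (Ioo 0 1)).NeBot := by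
    rw [nhdsWithin_Ioo_eq_nhdsGT zero_lt_one]
    infer_instance
  refine le_of_tendsto hlim' ?_
  filter_upwards [self_mem_nhdsWithin] with ε hε
  exact hbound ε hε

theorem lintegral_comp_add_smul_sub {m : ℕ} (f : EuclideanSpace ℝ (Fin (m + 1)) → ℝ≥0∞)
    (x : EuclideanSpace ℝ (Fin (m + 1))) {t : ℝ} (ht : 0 < t) :
    ∫⁻ y, f (x + t • (y - x)) = ENNReal.ofReal ((t ^ (m + 1))⁻¹) * ∫⁻ z, f z := by
  have h1 : ∫⁻ y, f (x + t • (y - x)) = ∫⁻ y, f (x + t • y) :=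
    lintegral_sub_right_eq_self (fun y => f (x + t • y)) x
  have h2 : ∫⁻ y, f (x + t • y) = ∫⁻ w, f (x + w) ∂(Measure.map (t • ·) volume) :=
    (lintegral_map_equiv (fun w => f (x + w))
      (Homeomorph.smulOfNeZero t ht.ne').toMeasurableEquiv).symm
  rw [h1, h2, Measure.map_addHaar_smul _ ht.ne', lintegral_smul_measure,
    lintegral_add_left_eq_self f x, finrank_euclideanSpace, Fintype.card_fin,
    abs_of_pos (by positivity), smul_eq_mul]

/-- The average of `u` over a large Whitney cube is controlled by a Riesz potential of the
gradient over the nontangential cone with vertex at a zero of `u`. -/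
theorem IsAdmissible.le_lintegral_boundaryCone {m : ℕ} {r : ℝ} (hr : 0 < r)
    {F : Set (EuclideanSpace ℝ (Fin (m + 1)))} {W : Set (Set (EuclideanSpace ℝ (Fin (m + 1))))}
    {Q₁ : Set (EuclideanSpace ℝ (Fin (m + 1)))} {u : EuclideanSpace ℝ (Fin (m + 1)) → ℝ}
    (h : IsAdmissible m r F W Q₁ u) {x : EuclideanSpace ℝ (Fin (m + 1))} (hx : x ∈ F) :
    ENNReal.ofReal ((1 / (10 * (m + 1))) ^ (m + 1) / 40) ≤
      ∫⁻ z in boundaryCone m r x,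
        ENNReal.ofReal ‖gradient u z‖ / ENNReal.ofReal (z (Fin.last m)) ^ m := by
  obtain ⟨hQm, s, hs, hvol⟩ := h.exists_cube hr
  have hs0 : 0 < s := lt_of_lt_of_le (by positivity) hs
  set G : EuclideanSpace ℝ (Fin (m + 1)) → ℝ≥0∞ := fun z => ENNReal.ofReal ‖gradient u z‖ with hG
  have hGm : Measurable G := (measurable_norm_gradient u).ennreal_ofReal
  have havg : ENNReal.ofReal (s ^ (m + 1) / 2) ≤ ∫⁻ y in Q₁, ‖u y‖ₑ := by
    have h1 := h.le_average
    rw [setAverage_eq, Measure.real, hvol, ENNReal.toReal_ofReal (by positivity), smul_eq_mul,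
      le_inv_mul_iff₀ (by positivity)] at h1
    refine le_trans ?_ (enorm_integral_le_lintegral_enorm _)
    rw [← ofReal_norm]
    refine ENNReal.ofReal_le_ofReal ?_
    refine le_trans ?_ (le_abs_self _)
    linarith
  have hxB := h.subset hx
  have hx0 : x (Fin.last m) = 0 := hxB.2
  -- If `z = x + t (y - x)` with `y ∈ Q₁`, then `z_last = t y_last` with `r / 10 ≤ y_last < r`,
  -- which confines `t` to this interval.
  set D : Set (ℝ × EuclideanSpace ℝ (Fin (m + 1))) :=
    {p | p.2 ∈ boundaryCone m r x ∧ p.2 (Fin.last m) / r ≤ p.1 ∧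
      p.1 ≤ 10 * p.2 (Fin.last m) / r} with hD
  have hlast : Measurable fun p : ℝ × EuclideanSpace ℝ (Fin (m + 1)) => p.2 (Fin.last m) :=
    (EuclideanSpace.proj (𝕜 := ℝ) (Fin.last m)).measurable.comp measurable_snd
  have hDm : MeasurableSet D :=
    (measurable_snd (measurableSet_boundaryCone m r x)).inter
      ((measurableSet_le (hlast.div_const r) measurable_fst).inter
        (measurableSet_le measurable_fst ((hlast.const_mul 10).div_const r)))
  set H : ℝ × EuclideanSpace ℝ (Fin (m + 1)) → ℝ≥0∞ :=
    D.indicator fun p => ENNReal.ofReal ((r / p.2 (Fin.last m)) ^ (m + 1)) * G p.2 with hH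
  have hHm : Measurable H := by
    refine Measurable.indicator ?_ hDm
    exact ((measurable_const.div hlast).pow_const _).ennreal_ofReal.mul (hGm.comp measurable_snd)
  have hscale : ∀ t ∈ Ioo (0 : ℝ) 1, ∫⁻ y in Q₁, G (x + t • (y - x)) ≤ ∫⁻ z, H (t, z) := by
    intro t ht
    have ht0 : 0 < t := ht.1
    have hinv : ∀ y, x + t⁻¹ • (x + t • (y - x) - x) = y := fun y => by
      rw [add_sub_cancel_left, smul_smul, inv_mul_cancel₀ ht0.ne', one_smul, add_sub_cancel]
    set g : EuclideanSpace ℝ (Fin (m + 1)) → ℝ≥0∞ := fun z =>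
      Q₁.indicator (fun _ => G z) (x + t⁻¹ • (z - x)) with hg
    have h1 : ∫⁻ y in Q₁, G (x + t • (y - x)) = ∫⁻ y, g (x + t • (y - x)) := by
      rw [← lintegral_indicator hQm]
      refine lintegral_congr fun y => ?_
      simp only [hg, hinv]
      by_cases hy : y ∈ Q₁
      · rw [indicator_of_mem hy, indicator_of_mem hy]
      · rw [indicator_of_notMem hy, indicator_of_notMem hy]
    rw [h1, lintegral_comp_add_smul_sub g x ht0, ← lintegral_const_mul' _ _ ENNReal.ofReal_ne_top]
    refine lintegral_mono fun z => ?_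
    by_cases hz : x + t⁻¹ • (z - x) ∈ Q₁
    · obtain ⟨hyΩ, hy10⟩ := h.div_ten_le_last hr hz
      set y := x + t⁻¹ • (z - x) with hy
      have hzy : z = x + t • (y - x) := by
        rw [hy, add_sub_cancel_left, smul_smul, mul_inv_cancel₀ ht0.ne', one_smul,
          add_sub_cancel]
      have hzΩ : z ∈ upperHalfBall m r := by
        rw [hzy]
        exact add_smul_sub_mem_upperHalfBall hxB hyΩ ⟨ht.1, ht.2.le⟩
      have hzl : z (Fin.last m) = t * y (Fin.last m) := by
        rw [hzy]
        simp [hx0]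
      have hyr := last_lt_of_mem_upperHalfBall hyΩ
      have hzr : z (Fin.last m) ≤ t * r := by
        rw [hzl]
        gcongr
      have hdist : dist z x ≤ t * (2 * r) := by
        rw [dist_eq_norm, hzy, add_sub_cancel_left, norm_smul, Real.norm_of_nonneg ht0.le]
        gcongr
        have h1 := norm_sub_le y x
        have h2 := mem_ball_zero_iff.1 hxB.1
        have h3 := mem_ball_zero_iff.1 hyΩ.1
        linarith
      have hzl' : t * (r / 10) ≤ z (Fin.last m) := by
        rw [hzl]
        gcongr
      -- The aperture 20 of the cone is the ratio of `2 r`, a bound for `dist y x`, to `r / 10`, the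
      -- least height in `Q₁`.
      have hzD : (t, z) ∈ D := by
        refine ⟨⟨hzΩ, by linarith⟩, ?_, ?_⟩
        · rw [div_le_iff₀ hr]
          exact hzr
        · rw [le_div_iff₀ hr]
          linarith
      simp only [hH, hg]
      rw [indicator_of_mem hz, indicator_of_mem hzD]
      gcongr
      rw [← inv_pow]
      have : t⁻¹ ≤ r / z (Fin.last m) := by
        rw [inv_le_comm₀ ht0 (div_pos hr hzΩ.2), inv_div]
        exact hzD.2.1
      gcongr
    · simp only [hg]
      rw [indicator_of_notMem hz, mul_zero]
      exact zero_le
  -- The Jacobian bound has power `m + 1` of `r / z_last`; integrating over `t`, an interval of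
  -- length `9 z_last / r`, lowers it to `m`.
  have hslice : ∀ z, ∫⁻ t, H (t, z) ≤ (boundaryCone m r x).indicator (fun z =>
      ENNReal.ofReal (10 * r ^ m) * (G z / ENNReal.ofReal (z (Fin.last m)) ^ m)) z := by
    intro z
    by_cases hz : z ∈ boundaryCone m r x
    · have hz0 : 0 < z (Fin.last m) := hz.1.2
      rw [indicator_of_mem hz]
      have h1 : ∀ t, H (t, z) = (Icc (z (Fin.last m) / r) (10 * z (Fin.last m) / r)).indicator
          (fun _ => ENNReal.ofReal ((r / z (Fin.last m)) ^ (m + 1)) * G z) t := by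
        intro t
        by_cases ht : t ∈ Icc (z (Fin.last m) / r) (10 * z (Fin.last m) / r)
        · rw [indicator_of_mem ht, hH, indicator_of_mem (show (t, z) ∈ D from ⟨hz, ht⟩)]
        · rw [indicator_of_notMem ht, hH, indicator_of_notMem fun h => ht h.2]
      simp_rw [h1]
      rw [lintegral_indicator_const measurableSet_Icc, Real.volume_Icc]
      generalize G z = c
      rw [ENNReal.div_eq_inv_mul, ← ENNReal.ofReal_pow hz0.le,
        ← ENNReal.ofReal_inv_of_pos (by positivity), ← mul_assoc,
        ← ENNReal.ofReal_mul (by positivity), mul_right_comm, ← ENNReal.ofReal_mul (by positivity)]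
      refine mul_le_mul' (ENNReal.ofReal_le_ofReal ?_) le_rfl
      rw [← sub_div, div_pow, pow_succ, pow_succ]
      have : r ^ m * r / (z (Fin.last m) ^ m * z (Fin.last m)) *
          ((10 * z (Fin.last m) - z (Fin.last m)) / r) = 9 * r ^ m * (z (Fin.last m) ^ m)⁻¹ := by
        field_simp
        ring
      rw [this]
      gcongr
      norm_num
    · have : ∀ t, H (t, z) = 0 := fun t => indicator_of_notMem (fun h => hz h.1) _
      simp [this]
  have hmain : ENNReal.ofReal (s ^ (m + 1) / 2) ≤ ENNReal.ofReal (20 * r ^ (m + 1)) *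
      ∫⁻ z in boundaryCone m r x, G z / ENNReal.ofReal (z (Fin.last m)) ^ m :=
    calc ENNReal.ofReal (s ^ (m + 1) / 2) ≤ ∫⁻ y in Q₁, ‖u y‖ₑ := havg
      _ ≤ ∫⁻ y in Q₁, ENNReal.ofReal (2 * r) * ∫⁻ t in Ioo (0 : ℝ) 1, G (x + t • (y - x)) :=
          setLIntegral_mono' hQm fun y hy =>
            h.enorm_le_lintegral hx (h.div_ten_le_last hr hy).1
      _ = ENNReal.ofReal (2 * r) * ∫⁻ t in Ioo (0 : ℝ) 1, ∫⁻ y in Q₁, G (x + t • (y - x)) := by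
          rw [lintegral_const_mul' _ _ ENNReal.ofReal_ne_top, lintegral_lintegral_swap]
          refine (hGm.comp (f := fun p : EuclideanSpace ℝ (Fin (m + 1)) × ℝ =>
            x + p.2 • (p.1 - x)) ?_).aemeasurable
          exact Continuous.measurable (by fun_prop)
      _ ≤ ENNReal.ofReal (2 * r) * ∫⁻ t, ∫⁻ z, H (t, z) := by
          refine mul_le_mul_right ?_ _
          exact (setLIntegral_mono' measurableSet_Ioo hscale).trans
            (setLIntegral_le_lintegral _ _)
      _ = ENNReal.ofReal (2 * r) * ∫⁻ z, ∫⁻ t, H (t, z) := by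
          rw [lintegral_lintegral_swap (f := fun t z => H (t, z)) hHm.aemeasurable]
      _ ≤ ENNReal.ofReal (2 * r) * (ENNReal.ofReal (10 * r ^ m) *
            ∫⁻ z in boundaryCone m r x, G z / ENNReal.ofReal (z (Fin.last m)) ^ m) := by
          gcongr
          refine (lintegral_mono hslice).trans_eq ?_
          rw [lintegral_indicator (measurableSet_boundaryCone m r x),
            lintegral_const_mul' _ _ ENNReal.ofReal_ne_top]
      _ = _ := by
          rw [← mul_assoc, ← ENNReal.ofReal_mul (by positivity)]
          congr 2
          ring
  have h20 : (0 : ℝ) < 20 * r ^ (m + 1) := by positivity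
  rw [← ENNReal.mul_le_mul_iff_right (a := ENNReal.ofReal (20 * r ^ (m + 1)))
    (by simpa using h20) ENNReal.ofReal_ne_top, ← ENNReal.ofReal_mul h20.le]
  refine le_trans (ENNReal.ofReal_le_ofReal ?_) hmain
  have : (r / (10 * (m + 1))) ^ (m + 1) ≤ s ^ (m + 1) := by gcongr
  rw [div_eq_mul_one_div r, mul_pow] at this
  linarith

/-! ### Reduction of the energy bound to the choice of a threshold. -/

/-- The lower bound for the Riesz potentials over the cones. -/
noncomputable def potentialConst (m : ℕ) : ℝ := (1 / (10 * (m + 1))) ^ (m + 1) / 40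

theorem potentialConst_pos (m : ℕ) : 0 < potentialConst m := by
  unfold potentialConst
  positivity

/-- If small gradients, below the threshold `b (z_last)`, contribute little to the potentials and
the energy density dominates large gradients, then the energy has a lower bound. -/
theorem IsAdmissible.le_logEnergy {m : ℕ} {p lam r : ℝ} (hr : 0 < r)
    {F : Set (EuclideanSpace ℝ (Fin (m + 1)))} {W : Set (Set (EuclideanSpace ℝ (Fin (m + 1))))}
    {Q₁ : Set (EuclideanSpace ℝ (Fin (m + 1)))} {u : EuclideanSpace ℝ (Fin (m + 1)) → ℝ}
    (h : IsAdmissible m r F W Q₁ u) {b : ℝ → ℝ} (hbm : Measurable b)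
    (hb : ∫⁻ t in Ioo 0 r, ENNReal.ofReal (b t)
      ≤ ENNReal.ofReal (potentialConst m / (2 * 40 ^ m)))
    {A : ℝ} (hA : 0 < A)
    (hΦ : ∀ t ∈ Ioo 0 r, ∀ g, 0 ≤ g → b t ≤ g →
      A * g * t ≤ t ^ m * (g ^ p * Real.log (Real.exp 1 + g) ^ lam)) :
    ENNReal.ofReal (potentialConst m / (12 * (m + 1) * 43 ^ (m + 1)) * A * r)
      ≤ logEnergy p lam (upperHalfBall m r) u := by
  have hc0 := potentialConst_pos m
  set c := potentialConst m with hc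
  set Φ : EuclideanSpace ℝ (Fin (m + 1)) → ℝ≥0∞ := fun z => ENNReal.ofReal
    (‖gradient u z‖ ^ p * Real.log (Real.exp 1 + ‖gradient u z‖) ^ lam) with hΦdef
  have hgm := measurable_norm_gradient u
  have hΦm : Measurable Φ :=
    ((hgm.pow_const p).mul ((Real.measurable_log.comp (hgm.const_add _)).pow_const
      lam)).ennreal_ofReal
  have hlast : Measurable fun z : EuclideanSpace ℝ (Fin (m + 1)) => z (Fin.last m) :=
    (EuclideanSpace.proj (𝕜 := ℝ) (Fin.last m)).measurable
  have hpt : ∀ z ∈ upperHalfBall m r,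
      ENNReal.ofReal ‖gradient u z‖ / ENNReal.ofReal (z (Fin.last m)) ^ m
      ≤ ENNReal.ofReal (b (z (Fin.last m))) / ENNReal.ofReal (z (Fin.last m)) ^ m
        + (ENNReal.ofReal A)⁻¹ * (Φ z / ENNReal.ofReal (z (Fin.last m))) := by
    intro z hz
    have ht : 0 < z (Fin.last m) := hz.2
    have htr := last_lt_of_mem_upperHalfBall hz
    rcases le_total ‖gradient u z‖ (b (z (Fin.last m))) with hle | hle
    · refine le_trans ?_ le_self_add
      gcongr
    · refine le_trans ?_ le_add_self
      have h1 := hΦ _ ⟨ht, htr⟩ _ (norm_nonneg _) hle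
      rw [← ENNReal.ofReal_pow ht.le, ← ENNReal.ofReal_inv_of_pos hA,
        ← ENNReal.ofReal_div_of_pos (by positivity), ← ENNReal.ofReal_div_of_pos ht,
        ← ENNReal.ofReal_mul (by positivity)]
      refine ENNReal.ofReal_le_ofReal ?_
      rw [inv_mul_eq_div, div_div, div_le_div_iff₀ (by positivity) (by positivity)]
      linarith
  have hcone : ∀ x ∈ F, ENNReal.ofReal (A * (c / 2)) ≤
      ∫⁻ z in boundaryCone m r x, Φ z / ENNReal.ofReal (z (Fin.last m)) := by
    intro x hx
    have h1 : ENNReal.ofReal (c / 2) + ENNReal.ofReal (c / 2) ≤ ENNReal.ofReal (c / 2) +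
        (ENNReal.ofReal A)⁻¹ * ∫⁻ z in boundaryCone m r x,
          Φ z / ENNReal.ofReal (z (Fin.last m)) :=
      calc ENNReal.ofReal (c / 2) + ENNReal.ofReal (c / 2) = ENNReal.ofReal c := by
            rw [← ENNReal.ofReal_add (by positivity) (by positivity), add_halves]
        _ ≤ ∫⁻ z in boundaryCone m r x,
              ENNReal.ofReal ‖gradient u z‖ / ENNReal.ofReal (z (Fin.last m)) ^ m :=
            h.le_lintegral_boundaryCone hr hx
        _ ≤ ∫⁻ z in boundaryCone m r x,
              (ENNReal.ofReal (b (z (Fin.last m))) / ENNReal.ofReal (z (Fin.last m)) ^ m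
                + (ENNReal.ofReal A)⁻¹ * (Φ z / ENNReal.ofReal (z (Fin.last m)))) :=
            setLIntegral_mono' (measurableSet_boundaryCone m r x)
              fun z hz => hpt z hz.1
        _ = (∫⁻ z in boundaryCone m r x,
              ENNReal.ofReal (b (z (Fin.last m))) / ENNReal.ofReal (z (Fin.last m)) ^ m)
              + (ENNReal.ofReal A)⁻¹ * ∫⁻ z in boundaryCone m r x,
                Φ z / ENNReal.ofReal (z (Fin.last m)) := by
            rw [lintegral_add_right, lintegral_const_mul]
            · exact hΦm.div hlast.ennreal_ofReal
            · exact (hΦm.div hlast.ennreal_ofReal).const_mul _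
        _ ≤ _ := by
            gcongr
            -- The factor `40 ^ m` of the slices cancels the one in `hb`, so small gradients use up
            -- at most half of the constant `c`.
            refine (lintegral_boundaryCone_le x hbm.ennreal_ofReal).trans ?_
            refine (mul_le_mul_right hb _).trans_eq ?_
            rw [← ENNReal.ofReal_mul (by positivity)]
            congr 1
            field_simp
    have h2 := (ENNReal.add_le_add_iff_left ENNReal.ofReal_ne_top).1 h1
    rw [ENNReal.ofReal_mul hA.le]
    refine (mul_le_mul_right h2 _).trans_eq ?_
    rw [← mul_assoc, ENNReal.mul_inv_cancel (by simpa using hA) ENNReal.ofReal_ne_top, one_mul]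
  -- The 12 in the statement is `2 * 3 * 2`: from `c / 2`, from the content `r / 3`, and from the
  -- factor in this estimate.
  have hfin := mul_hausdorffContentOne_le_lintegral hr hΦm ENNReal.ofReal_ne_top hcone
  have hfin' := (mul_le_mul_right h.le_content _).trans hfin
  rw [← ENNReal.ofReal_mul (by positivity)] at hfin'
  have hK : (0 : ℝ) < 2 * (m + 1) * 43 ^ (m + 1) := by positivity
  rw [← ENNReal.mul_le_mul_iff_right (a := ENNReal.ofReal (2 * (m + 1) * 43 ^ (m + 1)))
    (by simpa using hK) ENNReal.ofReal_ne_top, ← ENNReal.ofReal_mul hK.le]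
  refine le_trans (ENNReal.ofReal_le_ofReal (le_of_eq ?_)) hfin'
  field_simp
  ring

/-! ### Calculus lemmas and the range `p > n - 1`. -/

/-- The improper fundamental theorem of calculus for a nonnegative derivative. -/
theorem lintegral_ofReal_deriv_eq_sub {r : ℝ} (hr : 0 < r) {B b : ℝ → ℝ}
    (hB : ContinuousOn B (Icc 0 r)) (hd : ∀ t ∈ Ioo 0 r, HasDerivAt B (b t) t)
    (hb : ∀ t ∈ Ioo 0 r, 0 ≤ b t) :
    ∫⁻ t in Ioo 0 r, ENNReal.ofReal (b t) = ENNReal.ofReal (B r - B 0) := by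
  have hi := intervalIntegral.integrableOn_deriv_of_nonneg hB hd hb
  rw [← ofReal_integral_eq_lintegral_ofReal (hi.mono_set Ioo_subset_Ioc_self),
    ← integral_Ioc_eq_integral_Ioo, ← intervalIntegral.integral_of_le hr.le,
    intervalIntegral.integral_eq_sub_of_hasDerivAt_of_le hr.le hB hd]
  · exact (intervalIntegrable_iff_integrableOn_Ioc_of_le hr.le).2 hi
  · filter_upwards [self_mem_ae_restrict measurableSet_Ioo] with t ht
    exact hb t ht

/-- Concavity of `log` between `e`, where it equals 1, and `e + y`. -/
theorem mul_log_exp_one_add_le {c y : ℝ} (hc0 : 0 < c) (hc1 : c ≤ 1) (hy : 0 ≤ y) :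
    c * Real.log (Real.exp 1 + y) ≤ Real.log (Real.exp 1 + c * y) := by
  have he := Real.exp_pos 1
  have h := strictConcaveOn_log_Ioi.concaveOn.2 (mem_Ioi.2 he)
    (mem_Ioi.2 (by positivity : 0 < Real.exp 1 + y)) (sub_nonneg.2 hc1) hc0.le (by ring)
  simp only [smul_eq_mul, Real.log_exp, mul_one] at h
  rw [show (1 - c) * Real.exp 1 + c * (Real.exp 1 + y) = Real.exp 1 + c * y by ring] at h
  linarith

theorem one_le_log_exp_one_add {y : ℝ} (hy : 0 ≤ y) : 1 ≤ Real.log (Real.exp 1 + y) := by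
  rw [Real.le_log_iff_exp_le (by positivity)]
  linarith

theorem rpow_mul_log_rpow_ge_of_nonneg {lam ε η r s : ℝ} (hlam : 0 ≤ lam) (hε : 0 < ε)
    (hη0 : 0 < η) (hη1 : η ≤ 1) (hr : 0 < r) (hr1 : r < 1) (hs : η ≤ s) :
    η ^ ε * η ^ lam * Real.log (1 / r) ^ lam
      ≤ s ^ ε * Real.log (Real.exp 1 + s / r) ^ lam := by
  have hL : 0 < Real.log (1 / r) := Real.log_pos (by rw [lt_div_iff₀ hr]; linarith)
  have h1 : η * Real.log (1 / r) ≤ Real.log (Real.exp 1 + s / r) := by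
    calc η * Real.log (1 / r) ≤ η * Real.log (Real.exp 1 + 1 / r) := by
          gcongr
          linarith [Real.exp_pos 1]
      _ ≤ Real.log (Real.exp 1 + η * (1 / r)) := mul_log_exp_one_add_le hη0 hη1 (by positivity)
      _ ≤ _ := by
          rw [mul_one_div]
          gcongr
  have hs0 : 0 < s := hη0.trans_le hs
  rw [mul_assoc, ← Real.mul_rpow hη0.le hL.le]
  gcongr

/-- For negative `lam` the logarithm of a large `s` works against the bound, and the spare power `s
^ ε` pays for it. Since `log^lam (1/r)` blows up as `r → 1`, the radii must stay below some `r₀ <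
1`. -/
theorem exists_rpow_mul_log_rpow_ge_of_neg {lam ε η r₀ : ℝ} (hlam : lam < 0) (hε : 0 < ε)
    (hη0 : 0 < η) (hr₀ : 0 < r₀) (hr₁ : r₀ < 1) :
    ∃ c : ℝ, 0 < c ∧ ∀ r, 0 < r → r ≤ r₀ → ∀ s, η ≤ s →
      c * Real.log (1 / r) ^ lam ≤ s ^ ε * Real.log (Real.exp 1 + s / r) ^ lam := by
  -- With this exponent `(s ^ δ) ^ lam = s ^ (-ε)`, so it suffices to bound the logarithm by `K *
  -- log (1/r) * s ^ δ`.
  set δ : ℝ := ε / (-lam) with hδ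
  have hδ0 : 0 < δ := div_pos hε (by linarith)
  set L₀ := Real.log (1 / r₀) with hL₀
  have hL₀0 : 0 < L₀ := Real.log_pos (by rw [lt_div_iff₀ hr₀]; linarith)
  have he := Real.exp_pos 1
  set K : ℝ := (Real.exp 1 / η + 1) ^ δ / δ / L₀ + (η ^ δ)⁻¹ with hK
  have hK0 : 0 < K := by positivity
  refine ⟨K ^ lam, by positivity, fun r hr hrr s hs => ?_⟩
  have hs0 : 0 < s := hη0.trans_le hs
  have hL : L₀ ≤ Real.log (1 / r) := by
    rw [hL₀]
    gcongr
  have hL0 : 0 < Real.log (1 / r) := hL₀0.trans_le hL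
  have h1 : Real.log (Real.exp 1 + s) ≤ (Real.exp 1 / η + 1) ^ δ / δ * s ^ δ := by
    calc Real.log (Real.exp 1 + s) ≤ (Real.exp 1 + s) ^ δ / δ :=
          Real.log_le_rpow_div (by positivity) hδ0
      _ ≤ ((Real.exp 1 / η + 1) * s) ^ δ / δ := by
          have : Real.exp 1 + s ≤ (Real.exp 1 / η + 1) * s := by
            rw [add_mul, one_mul, div_mul_eq_mul_div, mul_div_assoc]
            have : 1 ≤ s / η := (one_le_div hη0).2 hs
            nlinarith
          gcongr
      _ = _ := by
          rw [Real.mul_rpow (by positivity) hs0.le]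
          ring
  have h2 : 1 ≤ (η ^ δ)⁻¹ * s ^ δ := by
    rw [inv_mul_eq_div, one_le_div (by positivity)]
    gcongr
  have h3 : Real.log (Real.exp 1 + s / r) ≤ Real.log (Real.exp 1 + s) + Real.log (1 / r) := by
    rw [← Real.log_mul (by positivity) (by positivity)]
    refine Real.log_le_log (by positivity) ?_
    rw [mul_one_div, add_div]
    gcongr
    rw [le_div_iff₀ hr]
    nlinarith
  have h4 : Real.log (Real.exp 1 + s / r) ≤ K * Real.log (1 / r) * s ^ δ := by
    set X := (Real.exp 1 / η + 1) ^ δ / δ with hX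
    have hX0 : 0 < X := by positivity
    have hsδ : 0 < s ^ δ := by positivity
    have h5 : X * s ^ δ ≤ X / L₀ * Real.log (1 / r) * s ^ δ := by
      gcongr
      rw [div_mul_eq_mul_div, le_div_iff₀ hL₀0]
      gcongr
    have h6 : Real.log (1 / r) ≤ (η ^ δ)⁻¹ * s ^ δ * Real.log (1 / r) :=
      le_mul_of_one_le_left hL0.le h2
    rw [hK]
    nlinarith
  have hpos : 0 < Real.log (Real.exp 1 + s / r) :=
    zero_lt_one.trans_le (one_le_log_exp_one_add (by positivity))
  have h7 := Real.rpow_le_rpow_of_nonpos hpos h4 hlam.le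
  rw [Real.mul_rpow (by positivity) (by positivity), Real.mul_rpow hK0.le hL0.le,
    ← Real.rpow_mul hs0.le, show δ * lam = -ε by rw [hδ, div_mul_eq_mul_div, div_neg, mul_div_cancel_right₀ _ hlam.ne]]
    at h7
  calc K ^ lam * Real.log (1 / r) ^ lam
      = s ^ ε * (K ^ lam * Real.log (1 / r) ^ lam * s ^ (-ε)) := by
        rw [Real.rpow_neg hs0.le]
        field_simp
    _ ≤ _ := by gcongr

/-- The energy bound above the critical exponent, for radii in a set `S ⊆ (0, 1)` on which the
logarithmic factor of the energy is under control. -/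
theorem exists_le_logEnergy_of_lt {m : ℕ} (hm : 1 ≤ m) {p lam : ℝ} (hp : (m : ℝ) < p) {S : Set ℝ}
    (hS : S ⊆ Ioo 0 1)
    (hlog : ∀ ε η : ℝ, 0 < ε → 0 < η → η ≤ 1 → ∃ c : ℝ, 0 < c ∧ ∀ r ∈ S, ∀ s, η ≤ s →
      c * Real.log (1 / r) ^ lam ≤ s ^ ε * Real.log (Real.exp 1 + s / r) ^ lam) :
    ∃ C : ℝ, 0 < C ∧ ∀ r ∈ S, ∀ F W Q₁ u, IsAdmissible m r F W Q₁ u →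
      ENNReal.ofReal (C * r ^ ((m : ℝ) + 1 - p) * Real.log (1 / r) ^ lam)
        ≤ logEnergy p lam (upperHalfBall m r) u := by
  have hm' : (1 : ℝ) ≤ m := by exact_mod_cast hm
  -- With `s = r g`, the power `s ^ (p - 1)` splits into `s ^ (q - 1)`, which absorbs the dependence
  -- on `t`, and `s ^ (p - q)`, which is spent on the logarithm. `κ` solves `(1 - κ)(q - 1) = m -
  -- 1`; it is positive because `q > m`, and this makes `t ^ (κ - 1)` integrable at 0.
  set q : ℝ := (p + m) / 2 with hq
  have hq1 : 0 < q - 1 := by linarith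
  set κ : ℝ := (q - m) / (q - 1) with hκ
  have hκ0 : 0 < κ := div_pos (by linarith) hq1
  have hκ1 : κ ≤ 1 := (div_le_one hq1).2 (by linarith)
  have hκq : (1 - κ) * (q - 1) = m - 1 := by
    rw [hκ]
    field_simp
    ring
  set c₁ : ℝ := potentialConst m / (2 * 40 ^ m) with hc₁
  have hc₁0 : 0 < c₁ := div_pos (potentialConst_pos m) (by positivity)
  -- The threshold has integral `η / κ` over `(0, r)`, which must not exceed `c₁`.
  set η : ℝ := min 1 (κ * c₁) with hη
  have hη0 : 0 < η := lt_min one_pos (by positivity)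
  have hη1 : η ≤ 1 := min_le_left _ _
  obtain ⟨c, hc0, hc⟩ := hlog (p - q) η (by linarith) hη0 hη1
  set c₂ : ℝ := potentialConst m / (12 * (m + 1) * 43 ^ (m + 1)) with hc₂
  have hc₂0 : 0 < c₂ := div_pos (potentialConst_pos m) (by positivity)
  refine ⟨c₂ * (η ^ (q - 1) * c), by positivity, fun r hrS F W Q₁ u h => ?_⟩
  obtain ⟨hr, hr1⟩ := hS hrS
  have hL : 0 < Real.log (1 / r) := Real.log_pos (by rw [lt_div_iff₀ hr]; linarith)
  have hint : ∫⁻ t in Ioo 0 r, ENNReal.ofReal (η * r ^ (-κ) * t ^ (κ - 1))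
      ≤ ENNReal.ofReal c₁ := by
    rw [lintegral_ofReal_deriv_eq_sub hr (B := fun t => η * r ^ (-κ) / κ * t ^ κ)]
    · refine ENNReal.ofReal_le_ofReal ?_
      rw [Real.zero_rpow hκ0.ne', mul_zero, sub_zero, div_mul_eq_mul_div, mul_assoc,
        ← Real.rpow_add hr, neg_add_cancel, Real.rpow_zero, mul_one, div_le_iff₀ hκ0, mul_comm]
      exact min_le_right _ _
    · exact continuousOn_const.mul (continuousOn_id.rpow_const fun t _ => Or.inr hκ0.le)
    · intro t ht
      have h1 := ((Real.hasDerivAt_rpow_const (p := κ) (Or.inl ht.1.ne')).const_mul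
        (η * r ^ (-κ) / κ))
      exact h1.congr_deriv (by rw [← mul_assoc, div_mul_cancel₀ _ hκ0.ne'])
    · intro t ht
      have := ht.1
      positivity
  have hΦ : ∀ t ∈ Ioo 0 r, ∀ g, 0 ≤ g → η * r ^ (-κ) * t ^ (κ - 1) ≤ g →
      η ^ (q - 1) * c * r ^ ((m : ℝ) - p) * Real.log (1 / r) ^ lam * g * t
        ≤ t ^ m * (g ^ p * Real.log (Real.exp 1 + g) ^ lam) := by
    intro t ht g _ hg
    have ht0 : 0 < t := ht.1
    have hg0 : 0 < g := lt_of_lt_of_le (by positivity) hg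
    set s := r * g with hs
    have hs0 : 0 < s := by positivity
    have hgs : g = s / r := by rw [hs]; field_simp
    have h1 : η * (r / t) ^ (1 - κ) ≤ s := by
      calc η * (r / t) ^ (1 - κ) = r * (η * r ^ (-κ) * t ^ (κ - 1)) := by
            rw [Real.div_rpow hr.le ht0.le, Real.rpow_sub hr, Real.rpow_one, Real.rpow_neg hr.le,
              show κ - 1 = -(1 - κ) by ring, Real.rpow_neg ht0.le]
            field_simp
        _ ≤ s := by
            rw [hs]
            gcongr
    have hηs : η ≤ s := by
      refine le_trans (le_mul_of_one_le_right hη0.le ?_) h1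
      exact Real.one_le_rpow ((one_le_div ht0).2 ht.2.le) (by linarith)
    have h2 : η ^ (q - 1) * (r / t) ^ ((m : ℝ) - 1) ≤ s ^ (q - 1) := by
      rw [← hκq, Real.rpow_mul (by positivity), ← Real.mul_rpow hη0.le (by positivity)]
      gcongr
    have h3 := hc r hrS s hηs
    rw [← hgs] at h3
    have hgp : g ^ p = g * (r ^ (1 - p) * (s ^ (q - 1) * s ^ (p - q))) := by
      rw [← Real.rpow_add hs0, show q - 1 + (p - q) = p - 1 by ring, hs,
        Real.mul_rpow hr.le hg0.le, ← mul_assoc (r ^ _), ← Real.rpow_add hr,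
        show 1 - p + (p - 1) = 0 by ring, Real.rpow_zero, one_mul, Real.rpow_sub hg0,
        Real.rpow_one]
      field_simp
    have htm : t ^ m = t * t ^ ((m : ℝ) - 1) := by
      rw [Real.rpow_sub ht0, Real.rpow_one, Real.rpow_natCast]
      field_simp
    have hrm : r ^ ((m : ℝ) - p) = t ^ ((m : ℝ) - 1) * r ^ (1 - p) * (r / t) ^ ((m : ℝ) - 1) := by
      rw [Real.div_rpow hr.le ht0.le, show (m : ℝ) - p = (1 - p) + (m - 1) by ring,
        Real.rpow_add hr]
      field_simp
    calc η ^ (q - 1) * c * r ^ ((m : ℝ) - p) * Real.log (1 / r) ^ lam * g * t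
        = t * t ^ ((m : ℝ) - 1) * g * r ^ (1 - p) * ((η ^ (q - 1) * (r / t) ^ ((m : ℝ) - 1)) *
            (c * Real.log (1 / r) ^ lam)) := by
          rw [hrm]
          ring
      _ ≤ t * t ^ ((m : ℝ) - 1) * g * r ^ (1 - p) * (s ^ (q - 1) *
            (s ^ (p - q) * Real.log (Real.exp 1 + g) ^ lam)) := by
          gcongr
      _ = _ := by
          rw [htm, hgp]
          ring
  have hfin := h.le_logEnergy hr (by fun_prop) hint (by positivity) hΦ
  refine le_trans (ENNReal.ofReal_le_ofReal (le_of_eq ?_)) hfin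
  rw [show (m : ℝ) + 1 - p = m - p + 1 by ring, Real.rpow_add hr, Real.rpow_one]
  ring

/-! ### The critical exponent `p = n - 1`. -/

theorem one_sub_log_le_three_mul_log {t : ℝ} (ht : 0 < t) :
    1 - Real.log t ≤ 3 * Real.log (Real.exp 1 + t ^ (-(1 / 2) : ℝ)) := by
  have hy : 0 < t ^ (-(1 / 2) : ℝ) := by positivity
  have h1 := one_le_log_exp_one_add hy.le
  have h2 : Real.log (t ^ (-(1 / 2) : ℝ)) ≤ Real.log (Real.exp 1 + t ^ (-(1 / 2) : ℝ)) :=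
    Real.log_le_log hy (by linarith [Real.exp_pos 1])
  rw [Real.log_rpow ht] at h2
  linarith

/-- A logarithm is beaten by any power; `δ` is chosen so that `δ (1 + κ) = 1/2`. It follows that the
critical threshold is at least a constant times `t ^ (-1/2)`, so gradients above it have logarithm
at least a constant times `1 - log t`. -/
theorem one_sub_log_rpow_le {t κ : ℝ} (ht : 0 < t) (ht1 : t < 1) (hκ : 0 < κ) :
    (1 / (2 * (1 + κ))) ^ (1 + κ) * Real.exp (-(1 / 2)) * t ^ (1 / 2 : ℝ)
      * (1 - Real.log t) ^ (1 + κ) ≤ 1 := by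
  set δ : ℝ := 1 / (2 * (1 + κ)) with hδ
  have hδ0 : 0 < δ := by positivity
  have hlog : Real.log t < 0 := Real.log_neg ht ht1
  have h1 : 1 - Real.log t ≤ (Real.exp 1 / t) ^ δ / δ := by
    have := Real.log_le_rpow_div (x := Real.exp 1 / t) (by positivity) hδ0
    rwa [Real.log_div (Real.exp_pos 1).ne' ht.ne', Real.log_exp] at this
  have h2 : (1 - Real.log t) ^ (1 + κ) ≤ ((Real.exp 1 / t) ^ δ / δ) ^ (1 + κ) := by
    have : 0 ≤ 1 - Real.log t := by linarith
    gcongr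
  rw [Real.div_rpow (by positivity) hδ0.le, ← Real.rpow_mul (by positivity),
    show δ * (1 + κ) = 1 / 2 by rw [hδ]; field_simp, Real.div_rpow (Real.exp_pos 1).le ht.le,
    Real.exp_one_rpow] at h2
  calc _ ≤ δ ^ (1 + κ) * Real.exp (-(1 / 2)) * t ^ (1 / 2 : ℝ) *
        (Real.exp (1 / 2) / t ^ (1 / 2 : ℝ) / δ ^ (1 + κ)) := by gcongr
    _ = 1 := by
        rw [Real.exp_neg]
        field_simp

theorem lintegral_inv_mul_one_sub_log_rpow {r κ a : ℝ} (hr : 0 < r) (hr1 : r < 1) (hκ : 0 < κ)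
    (ha : 0 ≤ a) :
    ∫⁻ t in Ioo 0 r, ENNReal.ofReal (a * (t⁻¹ * (1 - Real.log t) ^ (-κ - 1)))
      = ENNReal.ofReal (a / κ * (1 - Real.log r) ^ (-κ)) := by
  have hpos : ∀ t ∈ Ioc 0 r, 0 < 1 - Real.log t := fun t ht => by
    have := Real.log_neg ht.1 (ht.2.trans_lt hr1)
    linarith
  -- The antiderivative tends to 0 at `0+`, but the bare formula has the wrong value at 0 since
  -- `Real.log 0 = 0`.
  set B : ℝ → ℝ := fun t => if t ≤ 0 then 0 else a / κ * (1 - Real.log t) ^ (-κ) with hB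
  have hBe : ∀ t, 0 < t → B t = a / κ * (1 - Real.log t) ^ (-κ) := fun t ht =>
    if_neg (not_le.2 ht)
  have hB0 : B 0 = 0 := if_pos le_rfl
  have hd : ∀ t ∈ Ioc 0 r, HasDerivAt B (a * (t⁻¹ * (1 - Real.log t) ^ (-κ - 1))) t := by
    intro t ht
    have h1 : HasDerivAt (fun t => a / κ * (1 - Real.log t) ^ (-κ))
        (a / κ * (-t⁻¹ * (-κ) * (1 - Real.log t) ^ (-κ - 1))) t :=
      (((Real.hasDerivAt_log ht.1.ne').const_sub 1).rpow_const
        (Or.inl (hpos t ht).ne')).const_mul (a / κ)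
    have h2 : HasDerivAt (fun t => a / κ * (1 - Real.log t) ^ (-κ))
        (a * (t⁻¹ * (1 - Real.log t) ^ (-κ - 1))) t := by
      refine h1.congr_deriv ?_
      field_simp
    refine h2.congr_of_eventuallyEq ?_
    filter_upwards [lt_mem_nhds ht.1] with s hs
    exact hBe s hs
  have hc : ContinuousOn B (Icc 0 r) := by
    intro t ht
    rcases ht.1.eq_or_lt with rfl | ht0
    · have hlim : Filter.Tendsto (fun t => a / κ * (1 - Real.log t) ^ (-κ))
          (nhdsWithin 0 (Ioi 0)) (nhds 0) := by
        have h1 : Filter.Tendsto (fun t => 1 - Real.log t) (nhdsWithin 0 (Ioi 0))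
            Filter.atTop := by
          simp only [sub_eq_add_neg]
          exact Filter.tendsto_atTop_add_const_left _ 1
            (Filter.tendsto_neg_atBot_atTop.comp Real.tendsto_log_nhdsGT_zero)
        have h2 := ((tendsto_rpow_neg_atTop hκ).comp h1).const_mul (a / κ)
        simpa using h2
      have h3 : ContinuousWithinAt B (Ioi 0) 0 := by
        rw [ContinuousWithinAt, hB0]
        refine hlim.congr' ?_
        filter_upwards [self_mem_nhdsWithin] with t ht
        exact (hBe t ht).symm
      exact (continuousWithinAt_Ioi_iff_Ici.1 h3).mono Icc_subset_Ici_self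
    · exact (hd t ⟨ht0, ht.2⟩).continuousAt.continuousWithinAt
  rw [lintegral_ofReal_deriv_eq_sub hr hc (fun t ht => hd t ⟨ht.1, ht.2.le⟩), hB0, sub_zero,
    hBe r hr]
  intro t ht
  have := ht.1
  have := hpos t ⟨ht.1, ht.2.le⟩
  positivity

/-- The energy bound at the critical exponent. -/
theorem exists_le_logEnergy_critical {m : ℕ} (hm : 1 ≤ m) {lam : ℝ} (hlam : (m : ℝ) - 1 < lam) :
    ∃ C : ℝ, 0 < C ∧ ∀ r : ℝ, 0 < r → r < 1 → ∀ F W Q₁ u, IsAdmissible m r F W Q₁ u →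
      ENNReal.ofReal (C * r * Real.log (1 / r) ^ (lam - ((m : ℝ) - 1)))
        ≤ logEnergy m lam (upperHalfBall m r) u := by
  obtain ⟨k, rfl⟩ : ∃ k, m = k + 1 := ⟨m - 1, by omega⟩
  have hk : ((k + 1 : ℕ) : ℝ) - 1 = k := by push_cast; ring
  rw [hk] at hlam ⊢
  have hk0 : (0 : ℝ) ≤ k := k.cast_nonneg
  have hlam0 : 0 < lam := hk0.trans_lt hlam
  -- `κ` solves `lam - (1 + κ) k = κ`. The total power of `ℓ t` in the lower bound is then `κ`,
  -- positive exactly when `lam > k = n - 2`, so `ℓ t` may be replaced by the smaller `ℓ r`, and the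
  -- powers add up to `κ (k + 1) = lam - k`.
  set κ : ℝ := (lam - k) / (k + 1) with hκ
  have hκ0 : 0 < κ := div_pos (by linarith) (by linarith)
  have hκk : κ * (k + 1) = lam - k := div_mul_cancel₀ _ (by linarith)
  set c₁ : ℝ := potentialConst (k + 1) / (2 * 40 ^ (k + 1)) with hc₁
  have hc₁0 : 0 < c₁ := div_pos (potentialConst_pos _) (by positivity)
  set η : ℝ := min 1 (κ * c₁) with hη
  have hη0 : 0 < η := lt_min one_pos (by positivity)
  have hη1 : η ≤ 1 := min_le_left _ _
  set c₂ : ℝ := potentialConst (k + 1) / (12 * ((k + 1 : ℕ) + 1) * 43 ^ (k + 1 + 1)) with hc₂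
  have hc₂0 : 0 < c₂ := div_pos (potentialConst_pos _) (by positivity)
  set c₃ : ℝ := (1 / (2 * (1 + κ))) ^ (1 + κ) * Real.exp (-(1 / 2)) with hc₃
  have hc₃0 : 0 < c₃ := by positivity
  have hc₃1 : c₃ ≤ 1 := by
    refine mul_le_one₀ (Real.rpow_le_one (by positivity) ?_ (by linarith)) (Real.exp_pos _).le
      (Real.exp_le_one_iff.2 (by norm_num))
    rw [div_le_one (by positivity)]
    linarith
  refine ⟨c₂ * (η ^ k * (η * c₃ / 3) ^ lam), by positivity, fun r hr hr1 F W Q₁ u h => ?_⟩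
  -- The summand 1 keeps `ℓ ≥ 1` up to `r = 1`; it is dropped at the end, where `lam - k > 0` makes
  -- the power monotone.
  set ℓ : ℝ → ℝ := fun t => 1 - Real.log t with hℓ
  have hlogr : Real.log r < 0 := Real.log_neg hr hr1
  have hℓr : 1 ≤ ℓ r := by simp only [hℓ]; linarith
  have hℓr0 : 0 < ℓ r := by linarith
  have hint : ∫⁻ t in Ioo 0 r, ENNReal.ofReal (η * ℓ r ^ κ * (t⁻¹ * ℓ t ^ (-κ - 1)))
      ≤ ENNReal.ofReal c₁ := by
    rw [lintegral_inv_mul_one_sub_log_rpow hr hr1 hκ0 (by positivity)]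
    refine ENNReal.ofReal_le_ofReal ?_
    change η * ℓ r ^ κ / κ * ℓ r ^ (-κ) ≤ c₁
    rw [div_mul_eq_mul_div, mul_assoc, ← Real.rpow_add hℓr0, add_neg_cancel, Real.rpow_zero,
      mul_one, div_le_iff₀ hκ0, mul_comm]
    exact min_le_right _ _
  have hΦ : ∀ t ∈ Ioo 0 r, ∀ g, 0 ≤ g → η * ℓ r ^ κ * (t⁻¹ * ℓ t ^ (-κ - 1)) ≤ g →
      η ^ k * (η * c₃ / 3) ^ lam * ℓ r ^ (lam - k) * g * t
        ≤ t ^ (k + 1) * (g ^ ((k + 1 : ℕ) : ℝ) * Real.log (Real.exp 1 + g) ^ lam) := by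
    intro t ht g hg0 hg
    have ht0 : 0 < t := ht.1
    have hℓt : ℓ r ≤ ℓ t := sub_le_sub_left (Real.log_le_log ht0 ht.2.le) 1
    have hℓt0 : 0 < ℓ t := hℓr0.trans_le hℓt
    have h1 : η * ℓ r ^ κ * ℓ t ^ (-(1 + κ)) ≤ t * g := by
      calc _ = t * (η * ℓ r ^ κ * (t⁻¹ * ℓ t ^ (-κ - 1))) := by
            rw [show -(1 + κ) = -κ - 1 by ring]
            field_simp
        _ ≤ _ := by gcongr
    have h2 : η * c₃ * t ^ (-(1 / 2) : ℝ) ≤ g := by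
      have h3 := one_sub_log_rpow_le ht0 (ht.2.trans hr1) hκ0
      rw [← hc₃] at h3
      change c₃ * t ^ (1 / 2 : ℝ) * ℓ t ^ (1 + κ) ≤ 1 at h3
      have h4 : c₃ * t ^ (1 / 2 : ℝ) ≤ ℓ t ^ (-(1 + κ)) := by
        rwa [Real.rpow_neg hℓt0.le, ← one_div, le_div_iff₀ (by positivity)]
      have h5 : 1 ≤ ℓ r ^ κ := Real.one_le_rpow hℓr hκ0.le
      calc η * c₃ * t ^ (-(1 / 2) : ℝ) = η * 1 * (t⁻¹ * (c₃ * t ^ (1 / 2 : ℝ))) := by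
            have : t = t ^ (1 / 2 : ℝ) * t ^ (1 / 2 : ℝ) := by
              rw [← Real.rpow_add ht0]
              norm_num
            rw [Real.rpow_neg ht0.le]
            have h6 : (t ^ (1 / 2 : ℝ))⁻¹ = t⁻¹ * t ^ (1 / 2 : ℝ) := by
              nth_rewrite 2 [this]
              field_simp
            rw [h6]
            ring
        _ ≤ η * ℓ r ^ κ * (t⁻¹ * ℓ t ^ (-(1 + κ))) := by gcongr
        _ ≤ g := by
            rw [show -(1 + κ) = -κ - 1 by ring]
            exact hg
    have h3 : η * c₃ / 3 * ℓ t ≤ Real.log (Real.exp 1 + g) := by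
      have h4 := one_sub_log_le_three_mul_log ht0
      calc η * c₃ / 3 * ℓ t ≤ η * c₃ / 3 * (3 * Real.log (Real.exp 1 + t ^ (-(1 / 2) : ℝ))) := by
            gcongr
        _ = η * c₃ * Real.log (Real.exp 1 + t ^ (-(1 / 2) : ℝ)) := by ring
        _ ≤ Real.log (Real.exp 1 + η * c₃ * t ^ (-(1 / 2) : ℝ)) :=
            mul_log_exp_one_add_le (by positivity) (mul_le_one₀ hη1 hc₃0.le hc₃1) (by positivity)
        _ ≤ _ := by gcongr
    have h4 : η ^ k * ℓ r ^ (κ * k) * ℓ t ^ (-(1 + κ) * k) ≤ (t * g) ^ k := by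
      rw [Real.rpow_mul hℓr0.le, Real.rpow_mul hℓt0.le, Real.rpow_natCast, Real.rpow_natCast,
        ← mul_pow, ← mul_pow]
      gcongr
    have h5 : (η * c₃ / 3) ^ lam * ℓ t ^ lam ≤ Real.log (Real.exp 1 + g) ^ lam := by
      rw [← Real.mul_rpow (by positivity) hℓt0.le]
      gcongr
    have h6 : ℓ r ^ (lam - k) ≤ ℓ r ^ (κ * k) * (ℓ t ^ (-(1 + κ) * k) * ℓ t ^ lam) := by
      rw [← Real.rpow_add hℓt0, show -(1 + κ) * k + lam = κ by linarith,
        show lam - k = κ * k + κ by linarith, Real.rpow_add hℓr0]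
      gcongr
    calc η ^ k * (η * c₃ / 3) ^ lam * ℓ r ^ (lam - k) * g * t
        ≤ η ^ k * (η * c₃ / 3) ^ lam *
            (ℓ r ^ (κ * k) * (ℓ t ^ (-(1 + κ) * k) * ℓ t ^ lam)) * g * t := by gcongr
      _ = (η ^ k * ℓ r ^ (κ * k) * ℓ t ^ (-(1 + κ) * k)) *
            ((η * c₃ / 3) ^ lam * ℓ t ^ lam) * (g * t) := by ring
      _ ≤ (t * g) ^ k * Real.log (Real.exp 1 + g) ^ lam * (g * t) := by gcongr
      _ = _ := by
          rw [Real.rpow_natCast]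
          ring
  have hbm : Measurable fun t => η * ℓ r ^ κ * (t⁻¹ * ℓ t ^ (-κ - 1)) := by
    have : Measurable ℓ := Real.measurable_log.const_sub 1
    exact (measurable_inv.mul (this.pow_const _)).const_mul _
  have hfin := h.le_logEnergy hr hbm hint (by positivity) hΦ
  have h0 : 0 ≤ Real.log (1 / r) := by
    rw [one_div, Real.log_inv]
    linarith
  have h1 : Real.log (1 / r) ≤ ℓ r := by
    rw [one_div, Real.log_inv]
    simp only [hℓ]
    linarith
  refine le_trans (ENNReal.ofReal_le_ofReal ?_) hfin
  calc c₂ * (η ^ k * (η * c₃ / 3) ^ lam) * r * Real.log (1 / r) ^ (lam - k)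
      ≤ c₂ * (η ^ k * (η * c₃ / 3) ^ lam) * r * ℓ r ^ (lam - k) :=
        mul_le_mul_of_nonneg_left (Real.rpow_le_rpow h0 h1 (by linarith)) (by positivity)
    _ = _ := by ring

theorem mainTheorem6 (m : ℕ) (hm : 1 ≤ m) (p lam : ℝ) :
    -- the dimension is `n = m + 1`; first the range `n - 1 < p ≤ n`
    ((m : ℝ) < p → p ≤ (m : ℝ) + 1 →
      (0 ≤ lam → ∃ C : ℝ, 0 < C ∧ ∀ r : ℝ, 0 < r → r < 1 →
        ∀ F W Q₁ u, IsAdmissible m r F W Q₁ u →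
          ENNReal.ofReal (C * r ^ ((m : ℝ) + 1 - p) * Real.log (1 / r) ^ lam)
            ≤ logEnergy p lam (upperHalfBall m r) u) ∧
      (lam < 0 → ∀ r₀ : ℝ, 0 < r₀ → r₀ < 1 → ∃ C : ℝ, 0 < C ∧ ∀ r : ℝ, 0 < r → r ≤ r₀ →
        ∀ F W Q₁ u, IsAdmissible m r F W Q₁ u →
          ENNReal.ofReal (C * r ^ ((m : ℝ) + 1 - p) * Real.log (1 / r) ^ lam)
            ≤ logEnergy p lam (upperHalfBall m r) u)) ∧
    -- then `p = n - 1` and `lam > n - 2`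
    (p = (m : ℝ) → (m : ℝ) - 1 < lam →
      ∃ C : ℝ, 0 < C ∧ ∀ r : ℝ, 0 < r → r < 1 →
        ∀ F W Q₁ u, IsAdmissible m r F W Q₁ u →
          ENNReal.ofReal (C * r * Real.log (1 / r) ^ (lam - ((m : ℝ) - 1)))
            ≤ logEnergy p lam (upperHalfBall m r) u) := by
  refine ⟨fun hp _ => ⟨fun hlam => ?_, fun hlam r₀ hr₀ hr₁ => ?_⟩, fun hp hlam => ?_⟩
  · obtain ⟨C, hC, h⟩ := exists_le_logEnergy_of_lt (lam := lam) hm hp (S := Ioo 0 1) subset_rfl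
      fun ε η hε hη0 hη1 => ⟨η ^ ε * η ^ lam, by positivity, fun r hr s hs =>
        rpow_mul_log_rpow_ge_of_nonneg hlam hε hη0 hη1 hr.1 hr.2 hs⟩
    exact ⟨C, hC, fun r hr0 hr1 => h r ⟨hr0, hr1⟩⟩
  · obtain ⟨C, hC, h⟩ := exists_le_logEnergy_of_lt (lam := lam) hm hp (S := Ioc 0 r₀)
      (fun r hr => ⟨hr.1, hr.2.trans_lt hr₁⟩) fun ε η hε hη0 _ => by
        obtain ⟨c, hc0, hc⟩ := exists_rpow_mul_log_rpow_ge_of_neg hlam hε hη0 hr₀ hr₁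
        exact ⟨c, hc0, fun r hr => hc r hr.1 hr.2⟩
    exact ⟨C, hC, fun r hr0 hr1 => h r ⟨hr0, hr1⟩⟩
  · subst hp
    exact exists_le_logEnergy_critical hm hlam
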